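/- Notation. Let $d,n\ge 0$ be integers. For $f\in L^2(\mathbb R^d)$ and $k\in\mathbb Z^d$ put $T_kf(x)=f(x-k)$, let $\widehat f$ be the ($L^2$) Fourier transform, $\widehat f(\xi)=\int f(x)e^{-2\pi i x\cdot\xi}\,dx$ for integrable $f$, and let $\tau f(\omega)=(\widehat f(\omega+k))_{k\in\mathbb Z^d}$ be the fiber of $f$ at $\omega\in\mathbb T^d=[-1/2,1/2)^d$, which belongs to $\ell^2(\mathbb Z^d)$ for a.e. $\omega$. A closed subspace $V\subset L^2(\mathbb R^d)$ is shift-invariant if $T_kf\in V$ for all $f\in V$, $k\in\mathbb Z^d$. Its range function is $J(\omega)=\{\tau f(\omega): f\in V\}$, understood (up to a null set of $\omega$) as the closed linear span in $\ell^2(\mathbb Z^d)$ of the fibers at $\omega$ of a fixed countable dense subset of $V$. A family $(v_i)$ in a closed subspace $K$ of a Hilbert space is a frame of $K$ with bounds $A,B>0$ if $A\|f\|^2\le\sum_i|\langle f,v_i\rangle|^2\le B\|f\|^2$ for all $f\in K$. It is a Riesz basis of $K$ if it is a frame of $K$ (for some bounds) and there are $A',B'>0$ with $A'\|c\|_2\le\|\sum_i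 c_iv_i\|\le B'\|c\|_2$ for all finitely supported $c$. A family $(\phi_1,\dots,\phi_n)$ in $V$ is a Riesz generator set of $V$ if $(T_k\phi_i)_{1\le i\le n,\,k\in\mathbb Z^d}$ is a Riesz basis of $V$. Proposition. Let $V\subset L^2(\mathbb R^d)$ be a shift-invariant space and let $\{\phi_1,\dots,\phi_n\}$ and $\{\psi_1,\dots,\psi_n\}$ be two Riesz generator sets of $V$. Then the following are equivalent. (1) $\{\phi_i\}$ and $\{\psi_i\}$ are woven as generator sets: for every $I\subset\{1,\dots,n\}$ the family $\{\phi_i\}_{i\in I}\cup\{\psi_i\}_{i\notin I}$ is a Riesz generator set of $V$. (2) There exist $A,B>0$ such that for almost every $\omega\in\mathbb T^d$ the fibers $\{\tau\phi_i(\omega)\}$ and $\{\tau\psi_i(\omega)\}$ are woven in $J(\omega)$ with frame bounds $A$ and $B$, that is, for every $I\subset\{1,\dots,n\}$ the family $\{\tau\phi_i(\omega)\}_{i\in I}\cup\{\tau\psi_i(\omega)\}_{i\notin I}$ is a frame of $J(\omega)$ with bounds $A$ and $B$. -/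

import Mathlib

open MeasureTheory Set Filter Topology
open scoped FourierTransform ENNReal

noncomputable section

/-! ### Frames, Riesz sequences and Riesz bases of subspaces of a Hilbert space -/

section Hilbert

variable {H : Type*} [NormedAddCommGroup H] [InnerProductSpace ℂ H] {ι : Type*}

/-- `v` is a frame of the subspace `K` with frame bounds `A` and `B`: all `v i` belong to `K`, and
`A ‖f‖² ≤ ∑ |⟨f, v i⟩|² ≤ B ‖f‖²` for all `f ∈ K`. -/
def IsFrameWithBounds (K : Submodule ℂ H) (v : ι → H) (A B : ℝ) : Prop :=
  0 < A ∧ 0 < B ∧ (∀ i, v i ∈ K) ∧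
    ∀ f ∈ K, Summable (fun i => ‖inner ℂ (v i) f‖ ^ 2) ∧
      A * ‖f‖ ^ 2 ≤ ∑' i, ‖inner ℂ (v i) f‖ ^ 2 ∧
      ∑' i, ‖inner ℂ (v i) f‖ ^ 2 ≤ B * ‖f‖ ^ 2

/-- `v` is a frame of the subspace `K`. -/
def IsFrame (K : Submodule ℂ H) (v : ι → H) : Prop :=
  ∃ A B : ℝ, IsFrameWithBounds K v A B

/-- `v` is a Riesz sequence: `A ‖c‖₂ ≤ ‖∑ c i • v i‖ ≤ B ‖c‖₂` for all finitely supported `c`. -/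
def IsRieszSequence (v : ι → H) : Prop :=
  ∃ A B : ℝ, 0 < A ∧ 0 < B ∧ ∀ c : ι →₀ ℂ,
    A * √(∑ i ∈ c.support, ‖c i‖ ^ 2) ≤ ‖∑ i ∈ c.support, c i • v i‖ ∧
    ‖∑ i ∈ c.support, c i • v i‖ ≤ B * √(∑ i ∈ c.support, ‖c i‖ ^ 2)

/-- `v` is a Riesz basis of `K`: a Riesz sequence which is also a frame of `K`. -/
def IsRieszBasis (K : Submodule ℂ H) (v : ι → H) : Prop :=
  IsRieszSequence v ∧ IsFrame K v

open Classical in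
/-- The weaving `{v i}_{i ∈ I} ∪ {w i}_{i ∉ I}`, as a family over the common index set. -/
def weaving {X : Type*} (I : Set ι) (v w : ι → X) : ι → X :=
  fun i => if i ∈ I then v i else w i

/-- `v` and `w` are woven in `K` with frame bounds `A` and `B`: every weaving of `v` and `w`
(including `v` and `w` themselves) is a frame of `K` with bounds `A` and `B`. -/
def AreWovenWithBounds (K : Submodule ℂ H) (v w : ι → H) (A B : ℝ) : Prop :=
  ∀ I : Set ι, IsFrameWithBounds K (weaving I v w) A B

end Hilbert

/-! ### Shift-invariant spaces and Riesz generator sets -/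

/-- `ℝ^d`. -/
abbrev RSpace (d : ℕ) : Type := EuclideanSpace ℝ (Fin d)

/-- `L²(ℝ^d)`, complex valued. -/
abbrev L2Space (d : ℕ) : Type := Lp (α := RSpace d) ℂ 2 (volume : Measure (RSpace d))

/-- `ℓ²(ℤ^d)`, complex valued. -/
abbrev SeqSpace (d : ℕ) : Type := lp (fun _ : Fin d → ℤ => ℂ) 2

instance secondCountableTopology_L2Space (d : ℕ) : SecondCountableTopology (L2Space d) :=
  haveI : Fact ((2 : ℝ≥0∞) ≠ ∞) := ⟨ENNReal.ofNat_ne_top⟩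
  inferInstance

/-- The integer point `k ∈ ℤ^d` as an element of `ℝ^d`. -/
def latticePt {d : ℕ} (k : Fin d → ℤ) : RSpace d := WithLp.toLp 2 (fun i => (k i : ℝ))

/-- The translation `(T_k f)(x) = f (x - k)` on `L²(ℝ^d)`. -/
def intShift {d : ℕ} (k : Fin d → ℤ) (f : L2Space d) : L2Space d :=
  Lp.compMeasurePreserving (fun x : RSpace d => x - latticePt k)
    (measurePreserving_sub_right volume (latticePt k)) f

/-- Shift-invariant spaces: closed subspaces of `L²(ℝ^d)` stable under integer translations. -/
def IsShiftInvariantSpace {d : ℕ} (V : Submodule ℂ (L2Space d)) : Prop :=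
  IsClosed (V : Set (L2Space d)) ∧ ∀ f ∈ V, ∀ k : Fin d → ℤ, intShift k f ∈ V

/-- `φ` is a Riesz generator set of `V`: the family `T_k φ_i` (`i`, `k` arbitrary) is a Riesz
basis of `V`. -/
def IsRieszGeneratorSet {d n : ℕ} (V : Submodule ℂ (L2Space d)) (φ : Fin n → L2Space d) : Prop :=
  IsRieszBasis V (fun p : Fin n × (Fin d → ℤ) => intShift p.2 (φ p.1))

/-- The Riesz generator sets `φ` and `ψ` of `V` are woven: each weaving is a Riesz generator set. -/
def AreWovenGeneratorSets {d n : ℕ} (V : Submodule ℂ (L2Space d)) (φ ψ : Fin n → L2Space d) :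
    Prop :=
  ∀ I : Set (Fin n), IsRieszGeneratorSet V (weaving I φ ψ)

/-! ### Fibers and the range function -/

/-- The cube `[-1/2, 1/2)^d`, a copy of the torus `𝕋^d = ℝ^d / ℤ^d`. -/
def unitCube (d : ℕ) : Set (RSpace d) := {ω | ∀ i, ω i ∈ Ico (-1 / 2 : ℝ) (1 / 2)}

open Classical in
/-- The fiber `τ f (ω) = (f̂ (ω + k))_{k ∈ ℤ^d} ∈ ℓ²(ℤ^d)`, where `f̂` is the `L²` Fourier
transform. The sequence is square summable for almost every `ω`
(see `ae_memlp_fiber`); on the exceptional null set the value is `0`. -/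
def fiber {d : ℕ} (f : L2Space d) (ω : RSpace d) : SeqSpace d :=
  if h : Memℓp (fun k : Fin d → ℤ => (𝓕 f : L2Space d) (ω + latticePt k)) 2 then ⟨_, h⟩ else 0

/-- The range function `J_V(ω) = {τ f (ω) : f ∈ V}`, made precise pointwise by using a countable
dense subset of `V`: `J_V(ω)` is the closed linear span of the fibers at `ω` of its elements. Up to
a null set of `ω` this does not depend on the dense subset: `J_V` is the a.e. smallest family of
closed subspaces that contains the fibers of all `f ∈ V`
(see `fiber_mem_rangeFunction` and `rangeFunction_le`). -/
def rangeFunction {d : ℕ} (V : Submodule ℂ (L2Space d)) (ω : RSpace d) :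
    Submodule ℂ (SeqSpace d) :=
  (Submodule.span ℂ
    (Set.range fun m : ℕ => fiber (TopologicalSpace.denseSeq V m : L2Space d) ω)).topologicalClosure

/-! ### The fibers and the range function are well defined almost everywhere -/

theorem rangeFunction_le {d : ℕ} (V : Submodule ℂ (L2Space d))
    (K : RSpace d → Submodule ℂ (SeqSpace d)) (hK : ∀ ω, IsClosed (K ω : Set (SeqSpace d)))
    (h : ∀ f ∈ V, ∀ᵐ ω ∂volume.restrict (unitCube d), fiber f ω ∈ K ω) :
    ∀ᵐ ω ∂volume.restrict (unitCube d), rangeFunction V ω ≤ K ω := by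
  have h1 : ∀ᵐ ω ∂volume.restrict (unitCube d), ∀ m : ℕ,
      fiber (TopologicalSpace.denseSeq V m : L2Space d) ω ∈ K ω :=
    ae_all_iff.2 fun m => h _ (TopologicalSpace.denseSeq V m).2
  filter_upwards [h1] with ω hω
  refine Submodule.topologicalClosure_minimal _ ?_ (hK ω)
  rw [Submodule.span_le]
  rintro _ ⟨m, rfl⟩
  exact hω m

theorem measurableSet_unitCube (d : ℕ) : MeasurableSet (unitCube d) := by
  have : unitCube d = ⋂ i, (fun ω : RSpace d => ω i) ⁻¹' Ico (-1 / 2 : ℝ) (1 / 2) := by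
    ext ω; simp [unitCube]
  rw [this]
  exact MeasurableSet.iInter fun i => measurableSet_Ico.preimage (by fun_prop)

theorem lintegral_unitCube_tsum {d : ℕ} (F : RSpace d → ℝ≥0∞) (hF : AEMeasurable F volume) :
    ∫⁻ ω in unitCube d, ∑' k : Fin d → ℤ, F (ω + latticePt k) = ∫⁻ x, F x := by
  have hmp : ∀ k : Fin d → ℤ, MeasurePreserving (fun x : RSpace d => x + latticePt k)
      volume volume := fun k => measurePreserving_add_right volume _
  have hFk : ∀ k : Fin d → ℤ, AEMeasurable (fun ω => F (ω + latticePt k))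
      (volume.restrict (unitCube d)) := fun k =>
    (hF.comp_quasiMeasurePreserving (hmp k).quasiMeasurePreserving).restrict
  rw [lintegral_tsum hFk]
  have hS : ∀ k : Fin d → ℤ, MeasurableSet ((fun x : RSpace d => x - latticePt k) ⁻¹' unitCube d) :=
    fun k => (measurableSet_unitCube d).preimage (by fun_prop)
  have h1 : ∀ k : Fin d → ℤ, ∫⁻ ω in unitCube d, F (ω + latticePt k)
      = ∫⁻ x in (fun x : RSpace d => x - latticePt k) ⁻¹' unitCube d, F x := by
    intro k
    have := (hmp k).setLIntegral_comp_preimage_emb (measurableEmbedding_addRight _) F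
      ((fun x : RSpace d => x - latticePt k) ⁻¹' unitCube d)
    rw [← this]
    congr 2
    ext x
    rw [mem_preimage, mem_preimage, add_sub_cancel_right]
  have hU : ⋃ k : Fin d → ℤ, (fun x : RSpace d => x - latticePt k) ⁻¹' unitCube d = univ := by
    refine eq_univ_of_forall fun x => mem_iUnion.2 ?_
    refine ⟨fun i => ⌊x i + 1 / 2⌋, fun i => ?_⟩
    have a := Int.floor_le (x i + 1 / 2)
    have b := Int.lt_floor_add_one (x i + 1 / 2)
    change x i - ((⌊x i + 1 / 2⌋ : ℤ) : ℝ) ∈ Ico (-1 / 2 : ℝ) (1 / 2)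
    constructor <;> linarith
  rw [tsum_congr h1, ← lintegral_iUnion hS, hU, setLIntegral_univ]
  · intro k l hkl
    rw [Function.onFun, Set.disjoint_left]
    intro x hx hy
    apply hkl
    funext i
    have a : x i - (k i : ℝ) ∈ Ico (-1 / 2 : ℝ) (1 / 2) := hx i
    have b : x i - (l i : ℝ) ∈ Ico (-1 / 2 : ℝ) (1 / 2) := hy i
    have c : (k i : ℝ) < l i + 1 := by linarith [a.1, b.2]
    have e : (l i : ℝ) < k i + 1 := by linarith [b.1, a.2]
    have c' : k i < l i + 1 := by exact_mod_cast c
    have e' : l i < k i + 1 := by exact_mod_cast e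
    omega

theorem lintegral_unitCube_fourier {d : ℕ} (f : L2Space d) :
    ∫⁻ ω in unitCube d, ∑' k : Fin d → ℤ, ‖(𝓕 f : L2Space d) (ω + latticePt k)‖ₑ ^ 2
      = ‖f‖ₑ ^ 2 := by
  have hm : AEMeasurable (fun x => ‖(𝓕 f : L2Space d) x‖ₑ ^ 2) volume :=
    ((Lp.aestronglyMeasurable (𝓕 f : L2Space d)).enorm).pow_const 2
  rw [lintegral_unitCube_tsum _ hm]
  have h1 : ‖f‖ₑ = ‖(𝓕 f : L2Space d)‖ₑ := by
    rw [← ofReal_norm, ← ofReal_norm, Lp.norm_fourier_eq]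
  rw [h1, Lp.enorm_def,
    eLpNorm_eq_lintegral_rpow_enorm_toReal two_ne_zero ENNReal.ofNat_ne_top, ← ENNReal.rpow_two,
    ← ENNReal.rpow_mul]
  simp

theorem memlp_two_of_tsum {d : ℕ} {a : (Fin d → ℤ) → ℂ} (h : ∑' k, ‖a k‖ₑ ^ 2 ≠ ∞) :
    Memℓp a 2 := by
  rw [memℓp_gen_iff (by simp)]
  have := ENNReal.summable_toReal h
  simpa using this

/-- Almost every fiber is square summable. -/
theorem ae_memlp_fiber {d : ℕ} (f : L2Space d) : ∀ᵐ ω ∂volume.restrict (unitCube d),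
    Memℓp (fun k : Fin d → ℤ => (𝓕 f : L2Space d) (ω + latticePt k)) 2 := by
  have hmp : ∀ k : Fin d → ℤ, MeasurePreserving (fun x : RSpace d => x + latticePt k)
      volume volume := fun k => measurePreserving_add_right volume _
  have hm : AEMeasurable (fun ω : RSpace d => ∑' k : Fin d → ℤ,
      ‖(𝓕 f : L2Space d) (ω + latticePt k)‖ₑ ^ 2) (volume.restrict (unitCube d)) :=
    AEMeasurable.tsum fun k =>
      ((((Lp.aestronglyMeasurable (𝓕 f : L2Space d)).enorm).comp_quasiMeasurePreserving
        (hmp k).quasiMeasurePreserving).pow_const 2).restrict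
  have := ae_lt_top' hm (by rw [lintegral_unitCube_fourier]; simp)
  filter_upwards [this] with ω hω
  exact memlp_two_of_tsum hω.ne

theorem ae_fiber_apply {d : ℕ} (f : L2Space d) : ∀ᵐ ω ∂volume.restrict (unitCube d),
    ∀ k, fiber f ω k = (𝓕 f : L2Space d) (ω + latticePt k) := by
  filter_upwards [ae_memlp_fiber f] with ω hω k
  simp [fiber, hω]

theorem ae_fiber_sub {d : ℕ} (f g : L2Space d) : ∀ᵐ ω ∂volume.restrict (unitCube d),
    fiber (f - g) ω = fiber f ω - fiber g ω := by
  have h1 : ∀ᵐ ω : RSpace d, ∀ k : Fin d → ℤ, (𝓕 (f - g) : L2Space d) (ω + latticePt k)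
      = (𝓕 f : L2Space d) (ω + latticePt k) - (𝓕 g : L2Space d) (ω + latticePt k) := by
    rw [ae_all_iff]
    intro k
    have h2 : (𝓕 (f - g) : L2Space d) = 𝓕 f - 𝓕 g :=
      map_sub (Lp.fourierTransformₗᵢ (RSpace d) ℂ) f g
    rw [h2]
    exact (measurePreserving_add_right volume (latticePt k)).quasiMeasurePreserving.ae
      (Lp.coeFn_sub (𝓕 f : L2Space d) (𝓕 g))
  filter_upwards [ae_restrict_of_ae h1, ae_fiber_apply f, ae_fiber_apply g,
    ae_fiber_apply (f - g)] with ω h h2 h3 h4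
  ext k
  rw [h4, h]
  simp [h2, h3]

theorem enorm_sq_fiber {d : ℕ} (f : L2Space d) (ω : RSpace d) :
    ‖fiber f ω‖ₑ ^ 2 ≤ ∑' k : Fin d → ℤ, ‖(𝓕 f : L2Space d) (ω + latticePt k)‖ₑ ^ 2 := by
  by_cases h : Memℓp (fun k : Fin d → ℤ => (𝓕 f : L2Space d) (ω + latticePt k)) 2
  · have h1 := lp.norm_rpow_eq_tsum (p := 2) (by simp) (fiber f ω)
    have h2 := (memℓp_gen_iff (p := 2) (by simp)).1 h
    simp only [fiber, h, dite_true] at h1 ⊢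
    simp only [ENNReal.toReal_ofNat, Real.rpow_ofNat] at h1 h2
    rw [← ofReal_norm, ← ENNReal.ofReal_pow (norm_nonneg _), h1,
      ENNReal.ofReal_tsum_of_nonneg (fun _ => by positivity) h2]
    refine (ENNReal.tsum_le_tsum fun k => ?_)
    rw [ENNReal.ofReal_pow (norm_nonneg _), ofReal_norm]
  · simp [fiber, h]

/-- The fibers of every `f ∈ V` lie in the range function of `V` almost everywhere. -/
theorem fiber_mem_rangeFunction {d : ℕ} (V : Submodule ℂ (L2Space d)) {f : L2Space d}
    (hf : f ∈ V) : ∀ᵐ ω ∂volume.restrict (unitCube d), fiber f ω ∈ rangeFunction V ω := by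
  have h0 : ∀ j : ℕ, ∃ m : ℕ,
      ‖(TopologicalSpace.denseSeq V m : L2Space d) - f‖ ≤ (1 / 2 : ℝ) ^ j := by
    intro j
    obtain ⟨m, hm⟩ := (TopologicalSpace.denseRange_denseSeq V).exists_dist_lt ⟨f, hf⟩
      (ε := (1 / 2 : ℝ) ^ j) (by positivity)
    refine ⟨m, ?_⟩
    rw [dist_comm] at hm
    rw [← dist_eq_norm]
    exact hm.le
  choose m hm using h0
  set u : ℕ → L2Space d := fun j => (TopologicalSpace.denseSeq V (m j) : L2Space d) with hu
  have hmp : ∀ k : Fin d → ℤ, MeasurePreserving (fun x : RSpace d => x + latticePt k)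
      volume volume := fun k => measurePreserving_add_right volume _
  have hmeas : ∀ g : L2Space d, AEMeasurable (fun ω : RSpace d => ∑' k : Fin d → ℤ,
      ‖(𝓕 g : L2Space d) (ω + latticePt k)‖ₑ ^ 2) (volume.restrict (unitCube d)) := fun g =>
    AEMeasurable.tsum fun k =>
      ((((Lp.aestronglyMeasurable (𝓕 g : L2Space d)).enorm).comp_quasiMeasurePreserving
        (hmp k).quasiMeasurePreserving).pow_const 2).restrict
  have hfin : ∫⁻ ω in unitCube d, ∑' j : ℕ, ∑' k : Fin d → ℤ,
      ‖(𝓕 (u j - f) : L2Space d) (ω + latticePt k)‖ₑ ^ 2 ≠ ∞ := by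
    rw [lintegral_tsum fun j => hmeas _]
    simp_rw [lintegral_unitCube_fourier]
    have hle : ∀ j, ‖u j - f‖ₑ ^ 2 ≤ ENNReal.ofReal ((1 / 4 : ℝ) ^ j) := by
      intro j
      rw [← ofReal_norm, ← ENNReal.ofReal_pow (norm_nonneg _)]
      refine ENNReal.ofReal_le_ofReal ?_
      calc ‖u j - f‖ ^ 2 ≤ ((1 / 2 : ℝ) ^ j) ^ 2 := by gcongr; exact hm j
        _ = (1 / 4 : ℝ) ^ j := by rw [← pow_mul, mul_comm, pow_mul]; norm_num
    refine ne_top_of_le_ne_top ?_ (ENNReal.tsum_le_tsum hle)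
    rw [← ENNReal.ofReal_tsum_of_nonneg (fun _ => by positivity)
      (summable_geometric_of_lt_one (by norm_num) (by norm_num))]
    exact ENNReal.ofReal_ne_top
  have hlt := ae_lt_top' (AEMeasurable.tsum fun j => hmeas (u j - f)) hfin
  have hsub : ∀ᵐ ω ∂volume.restrict (unitCube d), ∀ j, fiber (u j - f) ω
      = fiber (u j) ω - fiber f ω := ae_all_iff.2 fun j => ae_fiber_sub _ _
  filter_upwards [hlt, hsub] with ω hω hs
  have ht : Tendsto (fun j => ‖fiber (u j - f) ω‖ₑ ^ 2) atTop (𝓝 0) :=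
    tendsto_of_tendsto_of_tendsto_of_le_of_le tendsto_const_nhds
      (ENNReal.tendsto_atTop_zero_of_tsum_ne_top hω.ne) (fun _ => zero_le)
      (fun j => enorm_sq_fiber _ _)
  have ht2 : Tendsto (fun j => fiber (u j) ω) atTop (𝓝 (fiber f ω)) := by
    rw [tendsto_iff_norm_sub_tendsto_zero]
    have h3 := (ENNReal.tendsto_toReal ENNReal.zero_ne_top).comp ht
    have h4 : Tendsto (fun j => ‖fiber (u j - f) ω‖ ^ 2) atTop (𝓝 0) := by
      simpa [Function.comp_def] using h3
    have h5 := h4.sqrt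
    simpa [Real.sqrt_sq (norm_nonneg _), hs] using h5
  exact mem_closure_of_tendsto ht2
    (Eventually.of_forall fun j => Submodule.subset_span ⟨m j, rfl⟩)

end

/-! The Fourier transform followed by periodization turns translation by `k` into multiplication of
fibers by the character of frequency `-k`. So for fixed `f` and `i` the numbers `⟨T_k φ_i, f⟩` are
the Fourier coefficients of the bracket `ω ↦ ⟨τφ_i(ω), τf(ω)⟩` (`inner_intShift`), and by Parseval
the frame sum of the translates is the integral over the cube of the frame sum of the fibers.

Frame bounds therefore pass unchanged in both directions. Integration of the fiberwise bounds gives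
`isFrameWithBounds_of_ae_fiber`. Conversely, `V` is stable under cutting fibers off to a measurable
set (`exists_fiber_eq_indicator`), so the integrated inequality localizes to almost every `ω`
(`ae_isFrameWithBounds_fiber`). This gives (1) ⇒ (2), uniform bounds being available because there
are only finitely many weavings.

For (2) ⇒ (1) the lower Riesz bound of each weaving is also needed. The translates of `φ` form a
Riesz sequence, so the fibers of `φ` are almost everywhere `n` independent vectors of `J(ω)`
(`ae_linearIndependent_fiber`). A frame of `J(ω)` with only `n` members is then a basis whose lower
Riesz bound is governed by the same `A` (`IsFrameWithBounds.le_norm_sq_sum`), and this bound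
integrates to the translates (`le_norm_sq_sum_intShift`). -/

/-! ### Fourier series of integrable functions on the torus -/

/-- The Haar probability measure on `𝕋^d`. -/
noncomputable abbrev torusMeasure (d : ℕ) : Measure (UnitAddTorus (Fin d)) :=
  Measure.pi fun _ => AddCircle.haarAddCircle

/-- Integration against an integrable `h` is a bounded functional for the sup norm, and the
characters span a dense subspace of the continuous functions. -/
theorem integral_continuousMap_mul_eq_zero {d : ℕ} {h : UnitAddTorus (Fin d) → ℂ}
    (hh : Integrable h (torusMeasure d))
    (h0 : ∀ n, ∫ t, UnitAddTorus.mFourier n t * h t ∂torusMeasure d = 0)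
    (G : C(UnitAddTorus (Fin d), ℂ)) : ∫ t, G t * h t ∂torusMeasure d = 0 := by
  have hi : ∀ G : C(UnitAddTorus (Fin d), ℂ), Integrable (fun t => G t * h t) (torusMeasure d) :=
    fun G => hh.bdd_mul G.continuous.aestronglyMeasurable (c := ‖G‖)
      (Eventually.of_forall fun t => G.norm_coe_le_norm t)
  let Λ : C(UnitAddTorus (Fin d), ℂ) →L[ℂ] ℂ := LinearMap.mkContinuous
    { toFun := fun G => ∫ t, G t * h t ∂torusMeasure d
      map_add' := fun F G => by
        simp only [ContinuousMap.add_apply, add_mul]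
        exact integral_add (hi F) (hi G)
      map_smul' := fun c G => by
        simp only [ContinuousMap.smul_apply, smul_eq_mul, mul_assoc, RingHom.id_apply]
        exact integral_const_mul _ _ }
    (∫ t, ‖h t‖ ∂torusMeasure d) (fun G => by
      rw [mul_comm, ← integral_const_mul]
      refine norm_integral_le_of_norm_le (hh.norm.const_mul _) (Eventually.of_forall fun t => ?_)
      rw [norm_mul]
      exact mul_le_mul_of_nonneg_right (G.norm_coe_le_norm t) (norm_nonneg _))
  have hle : (Submodule.span ℂ (range (UnitAddTorus.mFourier (d := Fin d)))).topologicalClosure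
      ≤ LinearMap.ker Λ.toLinearMap := by
    refine Submodule.topologicalClosure_minimal _ ?_ Λ.isClosed_ker
    rw [Submodule.span_le]
    rintro _ ⟨n, rfl⟩
    exact h0 n
  rw [UnitAddTorus.span_mFourier_closure_eq_top] at hle
  exact hle (Submodule.mem_top (x := G))

/-- An integrable function on the torus whose Fourier coefficients all vanish is zero a.e. -/
theorem ae_eq_zero_of_fourierCoeff_torus {d : ℕ} {h : UnitAddTorus (Fin d) → ℂ}
    (hh : Integrable h (torusMeasure d))
    (h0 : ∀ n, ∫ t, UnitAddTorus.mFourier n t * h t ∂torusMeasure d = 0) :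
    h =ᵐ[torusMeasure d] 0 := by
  refine ae_eq_zero_of_forall_setIntegral_isClosed_eq_zero hh fun s hs => ?_
  -- Thickened indicators are continuous, bounded by 1, and converge pointwise to the indicator of
  -- the closed set `s`; dominated convergence does the rest.
  have hpos : ∀ n : ℕ, (0 : ℝ) < 1 / ((n : ℝ) + 1) := fun n => by positivity
  have ht := thickenedIndicator_tendsto_indicator_closure hpos
    tendsto_one_div_add_atTop_nhds_zero_nat s
  rw [hs.closure_eq] at ht
  let G : ℕ → C(UnitAddTorus (Fin d), ℂ) := fun n =>
    ⟨fun t => (((thickenedIndicator (hpos n) s t : NNReal) : ℝ) : ℂ), by fun_prop⟩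
  have hlim : Tendsto (fun n => ∫ t, G n t * h t ∂torusMeasure d) atTop
      (𝓝 (∫ t, s.indicator h t ∂torusMeasure d)) := by
    refine tendsto_integral_of_dominated_convergence (fun t => ‖h t‖)
      (fun n => (G n).continuous.aestronglyMeasurable.mul hh.aestronglyMeasurable) hh.norm
      (fun n => Eventually.of_forall fun t => ?_) (Eventually.of_forall fun t => ?_)
    · rw [norm_mul]
      refine mul_le_of_le_one_left (norm_nonneg _) ?_
      have h1 := thickenedIndicator_le_one (hpos n) s t
      simpa [G] using h1
    · have h1 := (tendsto_pi_nhds.1 ht) t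
      have h2 : Tendsto (fun n => G n t) atTop
          (𝓝 (((s.indicator (fun _ => (1 : NNReal)) t : NNReal) : ℝ) : ℂ)) := by
        exact (Complex.continuous_ofReal.comp NNReal.continuous_coe).tendsto _ |>.comp h1
      have h3 := h2.mul_const (h t)
      by_cases hts : t ∈ s <;> simpa [hts] using h3
  simp_rw [fun n => integral_continuousMap_mul_eq_zero hh h0 (G n)] at hlim
  rw [← integral_indicator hs.measurableSet]
  exact tendsto_nhds_unique hlim tendsto_const_nhds

theorem hasSum_sq_fourierCoeff_torus {d : ℕ} {h : UnitAddTorus (Fin d) → ℂ}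
    (hh : MemLp h 2 (torusMeasure d)) :
    HasSum (fun n => ‖∫ t, UnitAddTorus.mFourier n t * h t ∂torusMeasure d‖ ^ 2)
      (∫ t, ‖h t‖ ^ 2 ∂torusMeasure d) := by
  have h1 := UnitAddTorus.hasSum_sq_mFourierCoeff (hh.toLp h)
  have h2 : ∫ t, ‖hh.toLp h t‖ ^ 2 ∂torusMeasure d = ∫ t, ‖h t‖ ^ 2 ∂torusMeasure d :=
    integral_congr_ae (by filter_upwards [hh.coeFn_toLp] with t ht; rw [ht])
  have h3 : ∀ n, UnitAddTorus.mFourierCoeff (hh.toLp h) n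
      = ∫ t, UnitAddTorus.mFourier (-n) t * h t ∂torusMeasure d := fun n =>
    integral_congr_ae (by filter_upwards [hh.coeFn_toLp] with t ht; rw [ht, smul_eq_mul])
  rw [← h2]
  -- `mFourierCoeff` integrates against the character of index `-n`; reindexing by negation gives
  -- the sign that suits inner products with translates.
  refine ((Equiv.neg (Fin d → ℤ)).hasSum_iff.2 h1).congr_fun fun n => ?_
  simp [h3]

/-- Riesz–Fischer: an integrable function on the torus with square summable Fourier coefficients is
square integrable. -/
theorem memLp_two_of_summable_fourierCoeff_torus {d : ℕ} {h : UnitAddTorus (Fin d) → ℂ}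
    (hh : Integrable h (torusMeasure d))
    (hs : Summable fun n => ‖∫ t, UnitAddTorus.mFourier n t * h t ∂torusMeasure d‖ ^ 2) :
    MemLp h 2 (torusMeasure d) := by
  let a : (Fin d → ℤ) → ℂ := fun n => ∫ t, UnitAddTorus.mFourier (-n) t * h t ∂torusMeasure d
  have ha : Memℓp a 2 := by
    rw [memℓp_gen_iff (by simp)]
    simpa [a, Function.comp_def] using (Equiv.neg (Fin d → ℤ)).summable_iff.2 hs
  let c : lp (fun _ : Fin d → ℤ => ℂ) 2 := ⟨a, ha⟩
  -- `g` is the `L²` function with the coefficients of `h`. Uniqueness is applied to `h - g`, which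
  -- is a priori only integrable.
  let g : Lp ℂ 2 (torusMeasure d) := UnitAddTorus.mFourierBasis.repr.symm c
  have hg : ∀ n, ∫ t, UnitAddTorus.mFourier (-n) t * g t ∂torusMeasure d = a n := fun n => by
    have := UnitAddTorus.mFourierBasis_repr g n
    rw [show UnitAddTorus.mFourierBasis.repr g = c from LinearIsometryEquiv.apply_symm_apply _ _]
      at this
    exact this.symm
  have hgi : Integrable g (torusMeasure d) := (Lp.memLp g).integrable (by norm_num)
  have hi : ∀ (n : Fin d → ℤ) {u : UnitAddTorus (Fin d) → ℂ}, Integrable u (torusMeasure d) →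
      Integrable (fun t => UnitAddTorus.mFourier n t * u t) (torusMeasure d) := fun n u hu =>
    hu.bdd_mul (UnitAddTorus.mFourier n).continuous.aestronglyMeasurable
      (c := ‖UnitAddTorus.mFourier n‖)
      (Eventually.of_forall fun t => (UnitAddTorus.mFourier n).norm_coe_le_norm t)
  have h0 : (fun t => h t - g t) =ᵐ[torusMeasure d] 0 := by
    refine ae_eq_zero_of_fourierCoeff_torus (hh.sub hgi) fun n => ?_
    simp_rw [mul_sub]
    rw [integral_sub (hi n hh) (hi n hgi), sub_eq_zero]
    have := hg (-n)
    simp only [neg_neg, a] at this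
    exact this.symm
  refine (memLp_congr_ae ?_).1 (Lp.memLp g)
  filter_upwards [h0] with t ht
  exact (sub_eq_zero.1 ht).symm

/-! ### Fourier series of functions on the unit cube -/

/-- The quotient map `ℝ^d → 𝕋^d`. -/
def toTorus {d : ℕ} (x : RSpace d) : UnitAddTorus (Fin d) := fun i => (x i : UnitAddCircle)

/-- The section of the quotient map `ℝ^d → 𝕋^d` with values in the unit cube. -/
noncomputable def torusSection {d : ℕ} (t : UnitAddTorus (Fin d)) : RSpace d :=
  WithLp.toLp 2 fun i => (AddCircle.equivIco (1 : ℝ) (-1 / 2) (t i) : ℝ)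

theorem measurable_toTorus {d : ℕ} : Measurable (toTorus (d := d)) :=
  measurable_pi_lambda _ fun i => AddCircle.measurable_mk'.comp (by fun_prop)

theorem continuous_toTorus {d : ℕ} : Continuous (toTorus (d := d)) :=
  continuous_pi fun i => (AddCircle.continuous_mk' 1).comp (by fun_prop)

theorem measurable_torusSection {d : ℕ} : Measurable (torusSection (d := d)) := by
  refine (WithLp.measurable_toLp 2 _).comp (measurable_pi_lambda _ fun i => ?_)
  exact measurable_subtype_coe.comp
    ((AddCircle.measurableEquivIco (1 : ℝ) (-1 / 2)).measurable.comp (measurable_pi_apply i))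

theorem torusSection_toTorus {d : ℕ} {ω : RSpace d} (hω : ω ∈ unitCube d) :
    torusSection (toTorus ω) = ω := by
  ext i
  exact AddCircle.equivIco_coe_of_mem (p := (1 : ℝ)) (a := -1 / 2)
    (by have := hω i; norm_num at this ⊢; exact this)

theorem toTorus_add_latticePt {d : ℕ} (x : RSpace d) (k : Fin d → ℤ) :
    toTorus (x + latticePt k) = toTorus x := by
  funext i
  have : ((k i : ℝ) : UnitAddCircle) = 0 := by
    have := AddCircle.coe_period (1 : ℝ)
    rw [show (k i : ℝ) = k i • (1 : ℝ) by simp, AddCircle.coe_zsmul, this, smul_zero]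
  change ((x i + (k i : ℝ) : ℝ) : UnitAddCircle) = _
  rw [AddCircle.coe_add, this, add_zero]
  rfl

theorem measurePreserving_toTorus (d : ℕ) :
    MeasurePreserving toTorus (volume.restrict (unitCube d)) (torusMeasure d) := by
  have h1 : MeasurePreserving (fun x : RSpace d => (WithLp.ofLp x : Fin d → ℝ))
      (volume.restrict (unitCube d))
      (volume.restrict (univ.pi fun _ : Fin d => Ico (-1 / 2 : ℝ) (1 / 2))) := by
    have := (PiLp.volume_preserving_ofLp (Fin d)).restrict_preimage
      (s := univ.pi fun _ : Fin d => Ico (-1 / 2 : ℝ) (1 / 2))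
      (MeasurableSet.univ_pi fun _ => measurableSet_Ico)
    rwa [show WithLp.ofLp ⁻¹' (univ.pi fun _ : Fin d => Ico (-1 / 2 : ℝ) (1 / 2)) = unitCube d by
      ext x; simp [unitCube]] at this
  -- The cube is half-open on the right, the fundamental domain of `AddCircle.measurePreserving_mk`
  -- on the left; the two differ by a null set.
  have h2 : (volume : Measure (Fin d → ℝ)).restrict
      (univ.pi fun _ : Fin d => Ico (-1 / 2 : ℝ) (1 / 2))
      = Measure.pi fun _ : Fin d => volume.restrict (Ioc (-1 / 2 : ℝ) (-1 / 2 + 1)) := by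
    rw [volume_pi, Measure.restrict_pi_pi]
    congr 1
    funext i
    norm_num
    exact Measure.restrict_congr_set Ico_ae_eq_Ioc
  have h3 : (volume : Measure (AddCircle (1 : ℝ))) = AddCircle.haarAddCircle := by
    simp [AddCircle.volume_eq_smul_haarAddCircle]
  rw [h2] at h1
  have h4 := measurePreserving_pi
    (fun _ : Fin d => volume.restrict (Ioc (-1 / 2 : ℝ) (-1 / 2 + 1)))
    (fun _ : Fin d => AddCircle.haarAddCircle (T := (1 : ℝ)))
    (fun _ => h3 ▸ AddCircle.measurePreserving_mk 1 (-1 / 2))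
  exact h4.comp h1

theorem measurePreserving_torusSection (d : ℕ) :
    MeasurePreserving torusSection (torusMeasure d) (volume.restrict (unitCube d)) := by
  refine ⟨measurable_torusSection, ?_⟩
  rw [← (measurePreserving_toTorus d).map_eq,
    Measure.map_map measurable_torusSection measurable_toTorus]
  have : (torusSection ∘ toTorus : RSpace d → RSpace d) =ᵐ[volume.restrict (unitCube d)] id := by
    filter_upwards [ae_restrict_mem (measurableSet_unitCube d)] with ω hω
    exact torusSection_toTorus hω
  rw [Measure.map_congr this, Measure.map_id]

theorem integral_comp_torusSection {d : ℕ} {E : Type*} [NormedAddCommGroup E] [NormedSpace ℝ E]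
    {u : RSpace d → E} (hu : AEStronglyMeasurable u (volume.restrict (unitCube d))) :
    ∫ t, u (torusSection t) ∂torusMeasure d = ∫ ω in unitCube d, u ω := by
  have h := measurePreserving_torusSection d
  rw [← h.map_eq] at hu ⊢
  exact (integral_map h.aemeasurable hu).symm

/-- The character `ω ↦ exp (2 π i k · ω)` on `ℝ^d`. -/
noncomputable def character {d : ℕ} (k : Fin d → ℤ) (ω : RSpace d) : ℂ :=
  UnitAddTorus.mFourier k (toTorus ω)

theorem continuous_character {d : ℕ} (k : Fin d → ℤ) : Continuous (character k) :=
  (UnitAddTorus.mFourier k).continuous.comp continuous_toTorus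

theorem norm_character {d : ℕ} (k : Fin d → ℤ) (ω : RSpace d) : ‖character k ω‖ = 1 := by
  simp only [character, UnitAddTorus.mFourier, ContinuousMap.coe_mk, norm_prod, fourier_apply,
    Circle.norm_coe, Finset.prod_const_one]

theorem character_add_latticePt {d : ℕ} (k l : Fin d → ℤ) (ω : RSpace d) :
    character k (ω + latticePt l) = character k ω := by
  simp [character, toTorus_add_latticePt]

theorem character_neg {d : ℕ} (k : Fin d → ℤ) (ω : RSpace d) :
    character (-k) ω = starRingEnd ℂ (character k ω) := UnitAddTorus.mFourier_neg

theorem integral_mFourier_mul_comp_torusSection {d : ℕ} {h : RSpace d → ℂ}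
    (hh : AEStronglyMeasurable h (volume.restrict (unitCube d))) (k : Fin d → ℤ) :
    ∫ t, UnitAddTorus.mFourier k t * h (torusSection t) ∂torusMeasure d
      = ∫ ω in unitCube d, character k ω * h ω := by
  rw [← integral_comp_torusSection (u := fun ω => character k ω * h ω)
    ((continuous_character k).aestronglyMeasurable.mul hh)]
  refine integral_congr_ae (Eventually.of_forall fun t => ?_)
  have : toTorus (torusSection t) = t := by
    funext i
    exact AddCircle.coe_equivIco
  simp only [character, this]

theorem ae_eq_zero_of_fourierCoeff_unitCube {d : ℕ} {h : RSpace d → ℂ} (hh : IntegrableOn h (unitCube d))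
    (h0 : ∀ k, ∫ ω in unitCube d, character k ω * h ω = 0) :
    ∀ᵐ ω ∂volume.restrict (unitCube d), h ω = 0 := by
  have h1 := ae_eq_zero_of_fourierCoeff_torus
    ((measurePreserving_torusSection d).integrable_comp_of_integrable hh) (fun k => by
      rw [← h0 k, ← integral_mFourier_mul_comp_torusSection hh.aestronglyMeasurable]; rfl)
  filter_upwards [(measurePreserving_toTorus d).quasiMeasurePreserving.ae h1,
    ae_restrict_mem (measurableSet_unitCube d)] with ω hω hc
  simpa [torusSection_toTorus hc] using hω

theorem hasSum_sq_fourierCoeff_unitCube {d : ℕ} {h : RSpace d → ℂ}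
    (hh : MemLp h 2 (volume.restrict (unitCube d))) :
    HasSum (fun k => ‖∫ ω in unitCube d, character k ω * h ω‖ ^ 2)
      (∫ ω in unitCube d, ‖h ω‖ ^ 2) := by
  have h1 := hasSum_sq_fourierCoeff_torus
    (hh.comp_measurePreserving (measurePreserving_torusSection d))
  simp only [Function.comp_apply,
    integral_mFourier_mul_comp_torusSection hh.aestronglyMeasurable] at h1
  rwa [integral_comp_torusSection (u := fun ω => ‖h ω‖ ^ 2)
    (hh.aestronglyMeasurable.norm.pow 2)] at h1

theorem memLp_two_of_summable_fourierCoeff_unitCube {d : ℕ} {h : RSpace d → ℂ}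
    (hh : IntegrableOn h (unitCube d))
    (hs : Summable fun k => ‖∫ ω in unitCube d, character k ω * h ω‖ ^ 2) :
    MemLp h 2 (volume.restrict (unitCube d)) := by
  have h1 := memLp_two_of_summable_fourierCoeff_torus
    ((measurePreserving_torusSection d).integrable_comp_of_integrable hh) (by
      simpa only [Function.comp_apply,
        integral_mFourier_mul_comp_torusSection hh.aestronglyMeasurable] using hs)
  refine (memLp_congr_ae ?_).1 (h1.comp_measurePreserving (measurePreserving_toTorus d))
  filter_upwards [ae_restrict_mem (measurableSet_unitCube d)] with ω hω
  simp [torusSection_toTorus hω]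

/-! ### Periodization -/

/-- The tiling of `ℝ^d` by translates of the cube, as an identity of measures; in this form it also
applies to Bochner integrals. -/
theorem sum_map_add_latticePt (d : ℕ) :
    Measure.sum (fun k : Fin d → ℤ =>
      (volume.restrict (unitCube d)).map fun x : RSpace d => x + latticePt k) = volume := by
  ext s hs
  have hm : ∀ k : Fin d → ℤ, Measurable fun x : RSpace d => x + latticePt k :=
    fun k => by fun_prop
  have h := lintegral_unitCube_tsum (d := d) (s.indicator 1)
    ((measurable_one.indicator hs).aemeasurable)
  have hm' : ∀ k : Fin d → ℤ, Measurable fun x : RSpace d =>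
      s.indicator (1 : RSpace d → ℝ≥0∞) (x + latticePt k) :=
    fun k => (measurable_one.indicator hs).comp (hm k)
  rw [lintegral_indicator_one hs, lintegral_tsum fun k => (hm' k).aemeasurable] at h
  rw [Measure.sum_apply _ hs, ← h]
  refine tsum_congr fun k => ?_
  rw [← lintegral_indicator_one hs, lintegral_map (measurable_one.indicator hs) (hm k)]

theorem aestronglyMeasurable_comp_add_latticePt {d : ℕ} {E : Type*} [NormedAddCommGroup E]
    {G : RSpace d → E} (hG : AEStronglyMeasurable G volume) (k : Fin d → ℤ) :
    AEStronglyMeasurable (fun ω => G (ω + latticePt k)) (volume.restrict (unitCube d)) :=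
  (hG.comp_quasiMeasurePreserving
    (measurePreserving_add_right volume (latticePt k)).quasiMeasurePreserving).restrict

theorem integrableOn_unitCube_tsum {d : ℕ} {G : RSpace d → ℂ} (hG : Integrable G) :
    IntegrableOn (fun ω => ∑' k : Fin d → ℤ, G (ω + latticePt k)) (unitCube d) := by
  refine ⟨AEStronglyMeasurable.tsum
    fun k => aestronglyMeasurable_comp_add_latticePt hG.aestronglyMeasurable k, ?_⟩
  refine lt_of_le_of_lt (lintegral_mono fun ω => enorm_tsum_le_tsum_enorm) ?_
  rw [lintegral_unitCube_tsum (fun x => ‖G x‖ₑ) hG.aestronglyMeasurable.enorm]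
  exact hG.2

theorem integral_unitCube_tsum {d : ℕ} {G : RSpace d → ℂ} (hG : Integrable G) :
    ∫ ω in unitCube d, ∑' k : Fin d → ℤ, G (ω + latticePt k) = ∫ x, G x := by
  have hm := aestronglyMeasurable_comp_add_latticePt (d := d) hG.aestronglyMeasurable
  rw [integral_tsum hm]
  · have h := hasSum_integral_measure (f := G) (μ := fun k : Fin d → ℤ =>
      (volume.restrict (unitCube d)).map fun x : RSpace d => x + latticePt k)
      (by rwa [sum_map_add_latticePt])
    rw [sum_map_add_latticePt] at h
    rw [← h.tsum_eq]
    refine tsum_congr fun k => ?_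
    exact ((measurableEmbedding_addRight (latticePt k)).integral_map G).symm
  · rw [← lintegral_tsum fun k => (hm k).enorm,
      lintegral_unitCube_tsum (fun x => ‖G x‖ₑ) hG.aestronglyMeasurable.enorm]
    exact hG.2.ne

/-! ### Inner products of fibers -/

theorem ae_inner_fiber {d : ℕ} (f g : L2Space d) : ∀ᵐ ω ∂volume.restrict (unitCube d),
    ∑' k : Fin d → ℤ, inner ℂ ((𝓕 f : L2Space d) (ω + latticePt k))
      ((𝓕 g : L2Space d) (ω + latticePt k)) = inner ℂ (fiber f ω) (fiber g ω) := by
  filter_upwards [ae_fiber_apply f, ae_fiber_apply g] with ω hf hg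
  simp_rw [lp.inner_eq_tsum, hf, hg]

/-- The bracket is almost everywhere the periodization of a product of two `L²` functions. This
gives integrability only, which is why the uniqueness and Riesz–Fischer statements above start from
`L¹`. -/
theorem integrableOn_inner_fiber {d : ℕ} (f g : L2Space d) :
    IntegrableOn (fun ω => inner ℂ (fiber f ω) (fiber g ω)) (unitCube d) :=
  (integrableOn_unitCube_tsum (L2.integrable_inner (𝕜 := ℂ) (𝓕 f : L2Space d) (𝓕 g))).congr
    (ae_inner_fiber f g)

theorem integral_inner_fiber {d : ℕ} (f g : L2Space d) :
    ∫ ω in unitCube d, inner ℂ (fiber f ω) (fiber g ω) = inner ℂ f g := by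
  rw [← Lp.inner_fourier_eq, L2.inner_def,
    ← integral_unitCube_tsum (L2.integrable_inner (𝕜 := ℂ) (𝓕 f : L2Space d) (𝓕 g))]
  exact integral_congr_ae ((ae_inner_fiber f g).mono fun ω h => h.symm)

theorem integrableOn_norm_sq_fiber {d : ℕ} (f : L2Space d) :
    IntegrableOn (fun ω => ‖fiber f ω‖ ^ 2) (unitCube d) := by
  refine (integrableOn_inner_fiber f f).re.congr (Eventually.of_forall fun ω => ?_)
  exact (norm_sq_eq_re_inner (𝕜 := ℂ) (fiber f ω)).symm

theorem integral_norm_sq_fiber {d : ℕ} (f : L2Space d) :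
    ∫ ω in unitCube d, ‖fiber f ω‖ ^ 2 = ‖f‖ ^ 2 := by
  rw [norm_sq_eq_re_inner (𝕜 := ℂ), ← integral_inner_fiber]
  refine Eq.trans ?_ (integral_re (integrableOn_inner_fiber f f))
  exact integral_congr_ae (Eventually.of_forall fun ω =>
    norm_sq_eq_re_inner (𝕜 := ℂ) (fiber f ω))

/-! ### Fibers and periodic multipliers -/

/-- A periodic multiplier is constant on each coset `ω + ℤ^d`, hence acts as a scalar on the fiber.
Constants, characters and periodized indicators are the cases used. -/
theorem ae_fiber_of_fourier_eq_mul {d : ℕ} {f g : L2Space d} {m : RSpace d → ℂ}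
    (hm : ∀ (k : Fin d → ℤ) ω, m (ω + latticePt k) = m ω)
    (h : ∀ᵐ x, (𝓕 g : L2Space d) x = m x * (𝓕 f : L2Space d) x) :
    ∀ᵐ ω ∂volume.restrict (unitCube d), fiber g ω = m ω • fiber f ω := by
  have h1 : ∀ᵐ ω : RSpace d, ∀ k : Fin d → ℤ, (𝓕 g : L2Space d) (ω + latticePt k)
      = m (ω + latticePt k) * (𝓕 f : L2Space d) (ω + latticePt k) :=
    ae_all_iff.2 fun k =>
      (measurePreserving_add_right volume (latticePt k)).quasiMeasurePreserving.ae h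
  filter_upwards [ae_restrict_of_ae h1, ae_fiber_apply f, ae_fiber_apply g] with ω h hf hg
  ext k
  rw [hg, h, hm]
  simp [hf]

theorem ae_fiber_smul {d : ℕ} (c : ℂ) (f : L2Space d) : ∀ᵐ ω ∂volume.restrict (unitCube d),
    fiber (c • f) ω = c • fiber f ω := by
  refine ae_fiber_of_fourier_eq_mul (m := fun _ => c) (fun _ _ => rfl) ?_
  have h2 : (𝓕 (c • f) : L2Space d) = c • 𝓕 f :=
    map_smul (Lp.fourierTransformₗᵢ (RSpace d) ℂ) c f
  rw [h2]
  exact Lp.coeFn_smul c (𝓕 f : L2Space d)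

theorem ae_fiber_add {d : ℕ} (f g : L2Space d) : ∀ᵐ ω ∂volume.restrict (unitCube d),
    fiber (f + g) ω = fiber f ω + fiber g ω := by
  have h : f + g = f - (-1 : ℂ) • g := by simp
  rw [h]
  filter_upwards [ae_fiber_sub f ((-1 : ℂ) • g), ae_fiber_smul (-1) g] with ω h1 h2
  rw [h1, h2]
  simp

theorem ae_fiber_sum {d : ℕ} {ι : Type*} (s : Finset ι) (f : ι → L2Space d) :
    ∀ᵐ ω ∂volume.restrict (unitCube d), fiber (∑ i ∈ s, f i) ω = ∑ i ∈ s, fiber (f i) ω := by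
  classical
  induction s using Finset.induction_on with
  | empty =>
    filter_upwards [ae_fiber_smul 0 (0 : L2Space d)] with ω h
    simpa using h
  | insert i s hi ih =>
    simp_rw [Finset.sum_insert hi]
    filter_upwards [ih, ae_fiber_add (f i) (∑ i ∈ s, f i)] with ω h1 h2
    rw [h2, h1]

theorem ae_fiber_sum_smul {d : ℕ} {ι : Type*} (s : Finset ι) (c : ι → ℂ) (f : ι → L2Space d) :
    ∀ᵐ ω ∂volume.restrict (unitCube d),
      fiber (∑ i ∈ s, c i • f i) ω = ∑ i ∈ s, c i • fiber (f i) ω := by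
  filter_upwards [ae_fiber_sum s fun i => c i • f i,
    (Finset.eventually_all s).2 fun i _ => ae_fiber_smul (c i) (f i)] with ω h1 h2
  rw [h1]
  exact Finset.sum_congr rfl h2

/-! ### Fibers of translates -/

theorem memLp_character_mul {d : ℕ} (k : Fin d → ℤ) (f : L2Space d) :
    MemLp (fun x => character k x * f x) 2 volume :=
  (Lp.memLp f).congr_norm
    ((continuous_character k).aestronglyMeasurable.mul (Lp.aestronglyMeasurable f))
    (Eventually.of_forall fun x => by simp [norm_character])

theorem continuous_toLp_character_mul {d : ℕ} (k : Fin d → ℤ) :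
    Continuous fun f : L2Space d => (memLp_character_mul k f).toLp := by
  refine (LipschitzWith.of_dist_le' (K := 1) fun f g => ?_).continuous
  rw [one_mul, dist_eq_norm, dist_eq_norm]
  refine Lp.norm_le_norm_of_ae_le ?_
  filter_upwards [Lp.coeFn_sub (memLp_character_mul k f).toLp (memLp_character_mul k g).toLp,
    Lp.coeFn_sub f g, (memLp_character_mul k f).coeFn_toLp,
    (memLp_character_mul k g).coeFn_toLp] with x h1 h2 h3 h4
  rw [h1, h2, Pi.sub_apply, Pi.sub_apply, h3, h4, ← mul_sub, norm_mul, norm_character, one_mul]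

theorem character_eq_fourierChar {d : ℕ} (k : Fin d → ℤ) (x : RSpace d) :
    character k x = (Real.fourierChar (inner ℝ (latticePt k) x) : ℂ) := by
  rw [Real.fourierChar_apply]
  simp only [character, UnitAddTorus.mFourier, ContinuousMap.coe_mk, toTorus, fourier_coe_apply,
    PiLp.inner_apply, latticePt]
  rw [← Complex.exp_sum]
  congr 1
  simp only [RCLike.inner_apply, conj_trivial, Finset.mul_sum, Finset.sum_mul,
    Complex.ofReal_sum]
  push_cast
  exact Finset.sum_congr rfl fun i _ => by ring

theorem schwartz_fourier_comp_sub {d : ℕ} (k : Fin d → ℤ) (f : SchwartzMap (RSpace d) ℂ)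
    (x : RSpace d) :
    (𝓕 (f.compSubConstCLM ℂ (latticePt k))) x = character (-k) x * (𝓕 f) x := by
  rw [SchwartzMap.fourier_coe, SchwartzMap.fourier_coe]
  have h := VectorFourier.fourierIntegral_comp_add_right Real.fourierChar
    (volume : Measure (RSpace d)) (innerₗ (RSpace d)) f (-latticePt k)
  have h2 : -latticePt k = latticePt (-k) := by
    ext i; simp [latticePt]
  have h3 := congrFun h x
  rw [h2] at h3
  rw [character_eq_fourierChar]
  refine Eq.trans ?_ h3
  have h4 : (f.compSubConstCLM ℂ (latticePt k) : RSpace d → ℂ)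
      = f ∘ fun v => v + latticePt (-k) := by
    funext y
    simp [← h2, sub_eq_add_neg]
  rw [h4]
  rfl

/-- Both sides are continuous in `f`, and on the dense set of Schwartz functions the pointwise
formula for the Fourier integral applies. -/
theorem fourier_intShift {d : ℕ} (k : Fin d → ℤ) (f : L2Space d) :
    (𝓕 (intShift k f) : L2Space d) = (memLp_character_mul (-k) (𝓕 f : L2Space d)).toLp := by
  refine DenseRange.induction_on (p := fun f : L2Space d => (𝓕 (intShift k f) : L2Space d)
      = (memLp_character_mul (-k) (𝓕 f : L2Space d)).toLp)
    (SchwartzMap.denseRange_toLpCLM (E := RSpace d) (F := ℂ) (p := 2) (μ := volume)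
      ENNReal.ofNat_ne_top) f ?_ ?_
  · have hF : Continuous fun f : L2Space d => (𝓕 f : L2Space d) :=
      (Lp.fourierTransformₗᵢ (RSpace d) ℂ).continuous
    refine isClosed_eq (hF.comp ?_) ((continuous_toLp_character_mul (-k)).comp hF)
    exact (Lp.isometry_compMeasurePreserving _).continuous
  · intro f
    have h1 : intShift k (f.toLp 2) = (f.compSubConstCLM ℂ (latticePt k)).toLp 2 := by
      refine Lp.ext ?_
      filter_upwards [Lp.coeFn_compMeasurePreserving (f.toLp 2)
          (measurePreserving_sub_right volume (latticePt k)),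
        (measurePreserving_sub_right volume (latticePt k)).quasiMeasurePreserving.ae
          (f.coeFn_toLp 2 volume),
        (f.compSubConstCLM ℂ (latticePt k)).coeFn_toLp 2 volume] with x a b c
      rw [c]
      refine a.trans ?_
      exact b
    change (𝓕 (intShift k (f.toLp 2)) : L2Space d)
      = (memLp_character_mul (-k) (𝓕 (f.toLp 2) : L2Space d)).toLp
    rw [h1, SchwartzMap.toLp_fourier_eq]
    refine Lp.ext ?_
    filter_upwards [(memLp_character_mul (-k) (𝓕 (f.toLp 2) : L2Space d)).coeFn_toLp,
      (𝓕 f).coeFn_toLp 2 volume,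
      (𝓕 (f.compSubConstCLM ℂ (latticePt k))).coeFn_toLp 2 volume] with x a b c
    rw [a, c, SchwartzMap.toLp_fourier_eq, b, schwartz_fourier_comp_sub]

theorem ae_fiber_intShift {d : ℕ} (k : Fin d → ℤ) (f : L2Space d) :
    ∀ᵐ ω ∂volume.restrict (unitCube d),
      fiber (intShift k f) ω = character (-k) ω • fiber f ω := by
  refine ae_fiber_of_fourier_eq_mul (fun l ω => character_add_latticePt (-k) l ω) ?_
  rw [fourier_intShift]
  exact MemLp.coeFn_toLp _

/-- The inner products with the translates of `g` are the Fourier coefficients of the bracket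
product of the fibers. -/
theorem inner_intShift {d : ℕ} (k : Fin d → ℤ) (g f : L2Space d) :
    inner ℂ (intShift k g) f
      = ∫ ω in unitCube d, character k ω * inner ℂ (fiber g ω) (fiber f ω) := by
  rw [← integral_inner_fiber]
  refine integral_congr_ae ?_
  filter_upwards [ae_fiber_intShift k g] with ω h
  rw [h, inner_smul_left, ← character_neg, neg_neg]

theorem ae_inner_fiber_eq_zero {d : ℕ} {g f : L2Space d}
    (h : ∀ k : Fin d → ℤ, inner ℂ (intShift k g) f = 0) :
    ∀ᵐ ω ∂volume.restrict (unitCube d), inner ℂ (fiber g ω) (fiber f ω) = 0 :=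
  ae_eq_zero_of_fourierCoeff_unitCube (integrableOn_inner_fiber g f) fun k => by
    rw [← inner_intShift, h]

/-- A shift-invariant space is stable under multiplication of the fibers by indicator functions. -/
theorem exists_fiber_eq_indicator {d : ℕ} {V : Submodule ℂ (L2Space d)}
    (hV : IsShiftInvariantSpace V) {f : L2Space d} (hf : f ∈ V) {s : Set (RSpace d)}
    (hs : MeasurableSet s) :
    ∃ g ∈ V, ∀ᵐ ω ∂volume.restrict (unitCube d), fiber g ω = s.indicator (fiber f) ω := by
  -- `S` is the periodization of `s ∩ unitCube d`, so its indicator is a periodic multiplier.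
  set S : Set (RSpace d) := (fun x => torusSection (toTorus x)) ⁻¹' s with hS
  have hSm : MeasurableSet S := hs.preimage (measurable_torusSection.comp measurable_toTorus)
  have hmem : MemLp (S.indicator (𝓕 f : L2Space d)) 2 volume := (Lp.memLp _).indicator hSm
  set g : L2Space d := 𝓕⁻ hmem.toLp with hg
  have hFg : (𝓕 g : L2Space d) = hmem.toLp :=
    (Lp.fourierTransformₗᵢ (RSpace d) ℂ).apply_symm_apply _
  have h1 : ∀ᵐ ω ∂volume.restrict (unitCube d), fiber g ω = s.indicator (fiber f) ω := by
    have h2 : ∀ᵐ ω ∂volume.restrict (unitCube d),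
        fiber g ω = S.indicator (fun _ => (1 : ℂ)) ω • fiber f ω := by
      refine ae_fiber_of_fourier_eq_mul (fun k ω => ?_) ?_
      · have : ω + latticePt k ∈ S ↔ ω ∈ S := by
          simp [hS, toTorus_add_latticePt]
        by_cases h : ω ∈ S
        · rw [indicator_of_mem h, indicator_of_mem (this.2 h)]
        · rw [indicator_of_notMem h, indicator_of_notMem fun h' => h (this.1 h')]
      · rw [hFg]
        filter_upwards [hmem.coeFn_toLp] with x hx
        rw [hx]
        by_cases h : x ∈ S <;> simp [h]
    filter_upwards [h2, ae_restrict_mem (measurableSet_unitCube d)] with ω h hω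
    rw [h]
    by_cases h : ω ∈ s <;> simp [hS, indicator, torusSection_toTorus hω, h]
  refine ⟨g, ?_, h1⟩
  have : CompleteSpace V := hV.1.completeSpace_coe
  -- Any `u ⊥ V` is orthogonal to all translates of `f`, so the bracket of `f` and `u` vanishes
  -- almost everywhere, and still does after the cut-off. Hence `g ∈ Vᗮᗮ = V`.
  rw [← Submodule.orthogonal_orthogonal V]
  rw [Submodule.mem_orthogonal']
  intro u hu
  rw [← integral_inner_fiber]
  have h2 := ae_inner_fiber_eq_zero (g := f) (f := u) fun k =>
    Submodule.inner_right_of_mem_orthogonal (hV.2 f hf k) hu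
  refine integral_eq_zero_of_ae ?_
  filter_upwards [h1, h2] with ω h h'
  rw [h]
  by_cases hω : ω ∈ s <;> simp [hω, h']

/-! ### Frames and Riesz sequences in Hilbert spaces -/

section Hilbert

variable {H : Type*} [NormedAddCommGroup H] [InnerProductSpace ℂ H] {ι : Type*}

theorem isFrameWithBounds_iff_of_fintype [Fintype ι] {K : Submodule ℂ H} {v : ι → H} {A B : ℝ}
    (hA : 0 < A) (hB : 0 < B) : IsFrameWithBounds K v A B ↔ (∀ i, v i ∈ K) ∧
      ∀ f ∈ K, A * ‖f‖ ^ 2 ≤ ∑ i, ‖inner ℂ (v i) f‖ ^ 2 ∧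
        ∑ i, ‖inner ℂ (v i) f‖ ^ 2 ≤ B * ‖f‖ ^ 2 := by
  simp only [IsFrameWithBounds, hA, hB, true_and, tsum_fintype, (hasSum_fintype _).summable]

theorem IsFrameWithBounds.mono {K : Submodule ℂ H} {v : ι → H} {A B A' B' : ℝ}
    (h : IsFrameWithBounds K v A B) (hA' : 0 < A') (hA : A' ≤ A) (hB : B ≤ B') :
    IsFrameWithBounds K v A' B' := by
  obtain ⟨-, hB0, hv, h⟩ := h
  refine ⟨hA', hB0.trans_le hB, hv, fun f hf => ?_⟩
  obtain ⟨h1, h2, h3⟩ := h f hf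
  exact ⟨h1, (by gcongr : A' * ‖f‖ ^ 2 ≤ A * ‖f‖ ^ 2).trans h2,
    h3.trans (by gcongr)⟩

/-- The synthesis bound of a Bessel family. -/
theorem IsFrameWithBounds.norm_sq_sum_le {K : Submodule ℂ H} {v : ι → H} {A B : ℝ}
    (h : IsFrameWithBounds K v A B) (s : Finset ι) (c : ι → ℂ) :
    ‖∑ i ∈ s, c i • v i‖ ^ 2 ≤ B * ∑ i ∈ s, ‖c i‖ ^ 2 := by
  obtain ⟨-, hB, hv, h⟩ := h
  -- The upper frame bound is tested on the synthesized vector `F` itself; Cauchy–Schwarz then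
  -- leaves a factor `‖F‖²` to cancel.
  set F := ∑ i ∈ s, c i • v i with hF
  have hFK : F ∈ K := Submodule.sum_mem _ fun i _ => K.smul_mem _ (hv i)
  obtain ⟨h1, -, h3⟩ := h F hFK
  have h4 : ∑ i ∈ s, ‖inner ℂ (v i) F‖ ^ 2 ≤ B * ‖F‖ ^ 2 :=
    (h1.sum_le_tsum s fun _ _ => by positivity).trans h3
  have h5 : ‖F‖ ^ 2 ≤ ∑ i ∈ s, ‖c i‖ * ‖inner ℂ (v i) F‖ := by
    calc ‖F‖ ^ 2 = ‖inner ℂ F F‖ := by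
          rw [inner_self_eq_norm_sq_to_K]; simp
      _ = ‖∑ i ∈ s, starRingEnd ℂ (c i) * inner ℂ (v i) F‖ := by
          conv_lhs => rw [hF, sum_inner]
          simp_rw [inner_smul_left]
          rfl
      _ ≤ _ := (norm_sum_le _ _).trans_eq (by simp)
  have h6 : (‖F‖ ^ 2) ^ 2 ≤ (∑ i ∈ s, ‖c i‖ ^ 2) * (B * ‖F‖ ^ 2) :=
    calc (‖F‖ ^ 2) ^ 2 ≤ (∑ i ∈ s, ‖c i‖ * ‖inner ℂ (v i) F‖) ^ 2 := by gcongr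
      _ ≤ (∑ i ∈ s, ‖c i‖ ^ 2) * ∑ i ∈ s, ‖inner ℂ (v i) F‖ ^ 2 :=
        Finset.sum_mul_sq_le_sq_mul_sq _ _ _
      _ ≤ _ := by gcongr
  have h7 : 0 ≤ ∑ i ∈ s, ‖c i‖ ^ 2 := by positivity
  rcases (sq_nonneg ‖F‖).eq_or_lt with h0 | h0
  · rw [← h0]; positivity
  · refine le_of_mul_le_mul_right ?_ h0
    linarith

/-- The lower Riesz bound keeps `v p` at distance at least `A` from the span of the other vectors,
so its component orthogonal to the closure of that span is nonzero. -/
theorem IsRieszSequence.exists_inner_eq_zero [CompleteSpace H] {v : ι → H}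
    (h : IsRieszSequence v) (p : ι) :
    ∃ f : H, (∀ q, q ≠ p → inner ℂ (v q) f = 0) ∧ inner ℂ (v p) f ≠ 0 := by
  obtain ⟨A, B, hA, -, h⟩ := h
  set W : Submodule ℂ H := (Submodule.span ℂ (v '' {p}ᶜ)).topologicalClosure with hW
  have hp : v p ∉ W := by
    intro hp
    obtain ⟨y, hy, hd⟩ := Metric.mem_closure_iff.1 hp A hA
    obtain ⟨l, hl, rfl⟩ := (Finsupp.mem_span_image_iff_linearCombination ℂ).1 hy
    have hlp : l p = 0 := by
      by_contra hne
      exact (Finsupp.mem_supported ℂ l).1 hl (Finsupp.mem_support_iff.2 hne) rfl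
    set c : ι →₀ ℂ := Finsupp.single p 1 - l with hc
    have hcp : c p = 1 := by simp [hc, hlp]
    have h1 := (h c).1
    have h2 : ∑ i ∈ c.support, c i • v i = v p - Finsupp.linearCombination ℂ v l := by
      have : Finsupp.linearCombination ℂ v c = v p - Finsupp.linearCombination ℂ v l := by
        simp [hc]
      rw [← this, Finsupp.linearCombination_apply, Finsupp.sum]
    have h3 : (1 : ℝ) ≤ √(∑ i ∈ c.support, ‖c i‖ ^ 2) := by
      rw [Real.one_le_sqrt]
      have := Finset.single_le_sum (f := fun i => ‖c i‖ ^ 2) (fun _ _ => by positivity)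
        (Finsupp.mem_support_iff.2 (by rw [hcp]; exact one_ne_zero) : p ∈ c.support)
      simpa [hcp] using this
    rw [h2, ← dist_eq_norm] at h1
    nlinarith
  have : CompleteSpace W := (Submodule.isClosed_topologicalClosure _).completeSpace_coe
  have hsub : v p - W.starProjection (v p) ∈ Wᗮ := W.sub_starProjection_mem_orthogonal (v p)
  refine ⟨v p - W.starProjection (v p), fun q hq => ?_, fun h0 => hp ?_⟩
  · exact Submodule.inner_right_of_mem_orthogonal
      (Submodule.le_topologicalClosure _ (Submodule.subset_span (mem_image_of_mem v hq))) hsub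
  · have h1 : inner ℂ (W.starProjection (v p)) (v p - W.starProjection (v p)) = 0 :=
      Submodule.inner_right_of_mem_orthogonal (W.starProjection_apply_mem (v p)) hsub
    have h2 : inner ℂ (v p - W.starProjection (v p)) (v p - W.starProjection (v p)) = 0 := by
      rw [inner_sub_left, h0, h1, sub_zero]
    rw [inner_self_eq_zero, sub_eq_zero] at h2
    rw [h2]
    exact W.starProjection_apply_mem (v p)

/-- A frame of `n` vectors in a space containing `n` linearly independent vectors is a Riesz
sequence, with the same lower bound. -/
theorem IsFrameWithBounds.le_norm_sq_sum [Fintype ι] {K : Submodule ℂ H} {v w : ι → H} {A B : ℝ}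
    (h : IsFrameWithBounds K v A B) (hw : LinearIndependent ℂ w) (hwK : ∀ i, w i ∈ K)
    (c : ι → ℂ) : A * ∑ i, ‖c i‖ ^ 2 ≤ ‖∑ i, c i • v i‖ ^ 2 := by
  have hA : 0 < A := h.1
  obtain ⟨hv, h⟩ := (isFrameWithBounds_iff_of_fintype h.1 h.2.1).1 h
  -- The analysis map is injective by the lower frame bound, and `w` forces `K` to have full
  -- dimension, so `T` is bijective.
  let T : K →ₗ[ℂ] (ι → ℂ) := LinearMap.pi fun i => (innerₛₗ ℂ (v i)).comp K.subtype
  have hT : ∀ f i, T f i = inner ℂ (v i) (f : H) := fun _ _ => rfl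
  have hinj : Function.Injective T := by
    rw [← LinearMap.ker_eq_bot, LinearMap.ker_eq_bot']
    intro f hf
    have h1 := (h f f.2).1
    simp_rw [← hT, hf] at h1
    have h2 : ‖(f : H)‖ ^ 2 ≤ 0 := by
      refine nonpos_of_mul_nonpos_right (a := A) ?_ hA
      simpa using h1
    have h3 : ‖(f : H)‖ = 0 := by nlinarith [norm_nonneg (f : H)]
    simpa using h3
  have hfin : FiniteDimensional ℂ K := FiniteDimensional.of_injective T hinj
  have hwK' : LinearIndependent ℂ fun i => (⟨w i, hwK i⟩ : K) :=
    LinearIndependent.of_comp K.subtype hw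
  have hrank : Module.finrank ℂ K = Module.finrank ℂ (ι → ℂ) := by
    refine le_antisymm (LinearMap.finrank_le_finrank_of_injective hinj) ?_
    rw [Module.finrank_fintype_fun_eq_card]
    exact hwK'.fintype_card_le_finrank
  -- Write `c` as the analysis coefficients of some `f`. Pairing `∑ c i • v i` with `f` gives `∑ ‖c
  -- i‖²`, while the lower frame bound controls `‖f‖`.
  obtain ⟨f, hf⟩ := (LinearMap.injective_iff_surjective_of_finrank_eq_finrank hrank).1 hinj c
  have hc : ∀ i, inner ℂ (v i) (f : H) = c i := fun i => by rw [← hT, hf]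
  have h1 := (h f f.2).1
  simp_rw [hc] at h1
  set s := ∑ i, ‖c i‖ ^ 2 with hs
  have hs0 : 0 ≤ s := by positivity
  have h2 : s ≤ ‖∑ i, c i • v i‖ * ‖(f : H)‖ := by
    have h3 : inner ℂ (∑ i, c i • v i) (f : H) = (s : ℂ) := by
      rw [sum_inner, hs, Complex.ofReal_sum]
      refine Finset.sum_congr rfl fun i _ => ?_
      rw [inner_smul_left, hc, Complex.conj_mul']
      simp
    have h4 := norm_inner_le_norm (𝕜 := ℂ) (∑ i, c i • v i) (f : H)
    rwa [h3, Complex.norm_real, Real.norm_of_nonneg hs0] at h4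
  set X := ‖∑ i, c i • v i‖
  have h5 : s ^ 2 ≤ X ^ 2 * ‖(f : H)‖ ^ 2 := by rw [← mul_pow]; gcongr
  have h6 : A * s ^ 2 ≤ X ^ 2 * s := by
    calc A * s ^ 2 ≤ A * (X ^ 2 * ‖(f : H)‖ ^ 2) := by gcongr
      _ = X ^ 2 * (A * ‖(f : H)‖ ^ 2) := by ring
      _ ≤ _ := by gcongr
  rcases hs0.eq_or_lt with h0 | h0
  · rw [← h0, mul_zero]; positivity
  · refine le_of_mul_le_mul_right ?_ h0
    linarith

end Hilbert

/-! ### The range function -/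

/-- The sets `S ω` need not be subspaces, since frame inequalities do not cut out subspaces.
Combinations of the dense sequence with coefficients from countable dense sets involve only
countably many null sets; continuity and closedness give the rest. -/
theorem ae_rangeFunction_subset {d : ℕ} (V : Submodule ℂ (L2Space d))
    (S : RSpace d → Set (SeqSpace d)) (hS : ∀ ω, IsClosed (S ω))
    (h : ∀ f ∈ V, ∀ᵐ ω ∂volume.restrict (unitCube d), fiber f ω ∈ S ω) :
    ∀ᵐ ω ∂volume.restrict (unitCube d), (rangeFunction V ω : Set (SeqSpace d)) ⊆ S ω := by
  let u : ℕ → L2Space d := fun m => (TopologicalSpace.denseSeq V m : L2Space d)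
  let c : (M : ℕ) → ℕ → Fin M → ℂ := fun M => TopologicalSpace.denseSeq (Fin M → ℂ)
  have h1 : ∀ᵐ ω ∂volume.restrict (unitCube d), ∀ M j,
      ∑ i : Fin M, c M j i • fiber (u i) ω ∈ S ω := by
    refine ae_all_iff.2 fun M => ae_all_iff.2 fun j => ?_
    filter_upwards [h (∑ i : Fin M, c M j i • u i)
        (V.sum_mem fun i _ => V.smul_mem _ (TopologicalSpace.denseSeq V i).2),
      ae_fiber_sum_smul Finset.univ (c M j) fun i : Fin M => u i] with ω h2 h3
    rwa [← h3]
  filter_upwards [h1] with ω hω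
  refine closure_minimal (fun x hx => ?_) (hS ω)
  obtain ⟨a, rfl⟩ := Finsupp.mem_span_range_iff_exists_finsupp.1 hx
  obtain ⟨M, hM⟩ := Finset.exists_nat_subset_range a.support
  rw [Finsupp.sum_of_support_subset a hM _ (by simp), Finset.sum_range]
  refine (TopologicalSpace.denseRange_denseSeq (Fin M → ℂ)).induction_on
    (p := fun b : Fin M → ℂ => ∑ i : Fin M, b i • fiber (u i) ω ∈ S ω)
    (fun i : Fin M => a i) ?_ (hω M)
  exact (hS ω).preimage (by fun_prop)

/-! ### Frames of translates and frames of fibers -/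

theorem hasSum_sq_inner_intShift {d n : ℕ} {φ : Fin n → L2Space d} {f : L2Space d}
    (h : ∀ i, MemLp (fun ω => inner ℂ (fiber (φ i) ω) (fiber f ω)) 2
      (volume.restrict (unitCube d))) :
    HasSum (fun p : Fin n × (Fin d → ℤ) => ‖inner ℂ (intShift p.2 (φ p.1)) f‖ ^ 2)
      (∫ ω in unitCube d, ∑ i, ‖inner ℂ (fiber (φ i) ω) (fiber f ω)‖ ^ 2) := by
  have h1 : ∀ i, HasSum (fun k : Fin d → ℤ => ‖inner ℂ (intShift k (φ i)) f‖ ^ 2)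
      (∫ ω in unitCube d, ‖inner ℂ (fiber (φ i) ω) (fiber f ω)‖ ^ 2) := fun i => by
    simp_rw [inner_intShift]
    exact hasSum_sq_fourierCoeff_unitCube (h i)
  have h2 : Summable (fun p : Fin n × (Fin d → ℤ) => ‖inner ℂ (intShift p.2 (φ p.1)) f‖ ^ 2) :=
    (summable_prod_of_nonneg fun _ => by positivity).2
      ⟨fun i => (h1 i).summable, (hasSum_fintype _).summable⟩
  have h3 := h2.hasSum
  rw [h2.tsum_prod, tsum_fintype] at h3
  simp_rw [fun i => (h1 i).tsum_eq] at h3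
  rwa [integral_finsetSum _ fun i _ => (h i).integrable_norm_pow two_ne_zero]

/-- Riesz–Fischer for the bracket, with `inner_intShift` identifying its Fourier coefficients. -/
theorem memLp_inner_fiber_of_summable {d n : ℕ} {φ : Fin n → L2Space d} {f : L2Space d}
    (h : Summable fun p : Fin n × (Fin d → ℤ) => ‖inner ℂ (intShift p.2 (φ p.1)) f‖ ^ 2)
    (i : Fin n) : MemLp (fun ω => inner ℂ (fiber (φ i) ω) (fiber f ω)) 2
      (volume.restrict (unitCube d)) := by
  refine memLp_two_of_summable_fourierCoeff_unitCube (integrableOn_inner_fiber _ _) ?_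
  simp_rw [← inner_intShift]
  exact h.prod_factor i

theorem intShift_zero {d : ℕ} (f : L2Space d) : intShift 0 f = f := by
  refine Lp.ext ?_
  filter_upwards [Lp.coeFn_compMeasurePreserving f
    (measurePreserving_sub_right volume (latticePt (0 : Fin d → ℤ)))] with x hx
  have h0 : latticePt (0 : Fin d → ℤ) = 0 := by ext i; simp [latticePt]
  refine hx.trans ?_
  simp [h0]

/-- The fibers of a frame of translates are almost everywhere frames of the range function. -/
theorem ae_isFrameWithBounds_fiber {d n : ℕ} {V : Submodule ℂ (L2Space d)}
    (hV : IsShiftInvariantSpace V) {φ : Fin n → L2Space d} {A B : ℝ}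
    (h : IsFrameWithBounds V (fun p : Fin n × (Fin d → ℤ) => intShift p.2 (φ p.1)) A B) :
    ∀ᵐ ω ∂volume.restrict (unitCube d),
      IsFrameWithBounds (rangeFunction V ω) (fun i => fiber (φ i) ω) A B := by
  obtain ⟨hA, hB, hφ, h⟩ := h
  let N : L2Space d → RSpace d → ℝ := fun f ω => ∑ i, ‖inner ℂ (fiber (φ i) ω) (fiber f ω)‖ ^ 2
  have hN : ∀ f ∈ V, IntegrableOn (N f) (unitCube d) := fun f hf =>
    integrable_finsetSum _ fun i _ =>
      (memLp_inner_fiber_of_summable (h f hf).1 i).integrable_norm_pow two_ne_zero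
  -- The global frame inequality for the element of `V` whose fibers are those of `f` cut off to `s`
  -- is the integrated inequality over `s`; arbitrary `s` then gives the pointwise one.
  have hset : ∀ f ∈ V, ∀ s, MeasurableSet s →
      A * ∫ ω in s, ‖fiber f ω‖ ^ 2 ∂volume.restrict (unitCube d)
        ≤ ∫ ω in s, N f ω ∂volume.restrict (unitCube d) ∧
      ∫ ω in s, N f ω ∂volume.restrict (unitCube d)
        ≤ B * ∫ ω in s, ‖fiber f ω‖ ^ 2 ∂volume.restrict (unitCube d) := by
    intro f hf s hs
    obtain ⟨g, hg, hgf⟩ := exists_fiber_eq_indicator hV hf hs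
    obtain ⟨h1, h2, h3⟩ := h g hg
    have h4 := (hasSum_sq_inner_intShift (memLp_inner_fiber_of_summable h1)).tsum_eq
    have h5 : ∫ ω in unitCube d, ‖fiber g ω‖ ^ 2
        = ∫ ω in s, ‖fiber f ω‖ ^ 2 ∂volume.restrict (unitCube d) := by
      rw [← integral_indicator hs]
      refine integral_congr_ae ?_
      filter_upwards [hgf] with ω hω
      rw [hω]
      by_cases hωs : ω ∈ s <;> simp [hωs]
    have h6 : ∫ ω in unitCube d, N g ω
        = ∫ ω in s, N f ω ∂volume.restrict (unitCube d) := by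
      rw [← integral_indicator hs]
      refine integral_congr_ae ?_
      filter_upwards [hgf] with ω hω
      simp only [N, hω]
      by_cases hωs : ω ∈ s <;> simp [hωs]
    rw [h4, ← integral_norm_sq_fiber] at h2 h3
    rw [← h5, ← h6]
    exact ⟨h2, h3⟩
  have hae : ∀ f ∈ V, ∀ᵐ ω ∂volume.restrict (unitCube d),
      A * ‖fiber f ω‖ ^ 2 ≤ N f ω ∧ N f ω ≤ B * ‖fiber f ω‖ ^ 2 := by
    intro f hf
    have hi := integrableOn_norm_sq_fiber f
    have h1 : (fun ω => A * ‖fiber f ω‖ ^ 2) ≤ᵐ[volume.restrict (unitCube d)] N f := by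
      refine ae_le_of_forall_setIntegral_le (hi.const_mul A) (hN f hf) fun s hs _ => ?_
      rw [integral_const_mul]
      exact (hset f hf s hs).1
    have h2 : N f ≤ᵐ[volume.restrict (unitCube d)] fun ω => B * ‖fiber f ω‖ ^ 2 := by
      refine ae_le_of_forall_setIntegral_le (hN f hf) (hi.const_mul B) fun s hs _ => ?_
      rw [integral_const_mul]
      exact (hset f hf s hs).2
    exact h1.and h2
  -- So far the null set depends on `f`. Both inequalities define closed sets, so they extend to all
  -- of `J(ω)` off a single null set.
  have hrange := ae_rangeFunction_subset V (fun ω => {x | A * ‖x‖ ^ 2 ≤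
      ∑ i, ‖inner ℂ (fiber (φ i) ω) x‖ ^ 2} ∩
        {x | ∑ i, ‖inner ℂ (fiber (φ i) ω) x‖ ^ 2 ≤ B * ‖x‖ ^ 2})
    (fun ω => (isClosed_le (by fun_prop) (by fun_prop)).inter
      (isClosed_le (by fun_prop) (by fun_prop))) hae
  have hmem : ∀ᵐ ω ∂volume.restrict (unitCube d), ∀ i, fiber (φ i) ω ∈ rangeFunction V ω :=
    ae_all_iff.2 fun i => fiber_mem_rangeFunction V (by
      simpa [intShift_zero] using hφ (i, 0))
  filter_upwards [hrange, hmem] with ω h1 h2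
  exact (isFrameWithBounds_iff_of_fintype hA hB).2 ⟨h2, fun f hf => h1 hf⟩

/-- If the fibers of `φ` are almost everywhere frames of the range function, with uniform bounds,
then the translates of `φ` are a frame. -/
theorem isFrameWithBounds_of_ae_fiber {d n : ℕ} {V : Submodule ℂ (L2Space d)}
    (hV : IsShiftInvariantSpace V) {φ : Fin n → L2Space d} (hφ : ∀ i, φ i ∈ V) {A B : ℝ}
    (hA : 0 < A) (hB : 0 < B)
    (h : ∀ᵐ ω ∂volume.restrict (unitCube d),
      IsFrameWithBounds (rangeFunction V ω) (fun i => fiber (φ i) ω) A B) :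
    IsFrameWithBounds V (fun p : Fin n × (Fin d → ℤ) => intShift p.2 (φ p.1)) A B := by
  refine ⟨hA, hB, fun p => hV.2 _ (hφ p.1) p.2, fun f hf => ?_⟩
  have h1 : ∀ᵐ ω ∂volume.restrict (unitCube d),
      A * ‖fiber f ω‖ ^ 2 ≤ ∑ i, ‖inner ℂ (fiber (φ i) ω) (fiber f ω)‖ ^ 2 ∧
        ∑ i, ‖inner ℂ (fiber (φ i) ω) (fiber f ω)‖ ^ 2 ≤ B * ‖fiber f ω‖ ^ 2 := by
    filter_upwards [h, fiber_mem_rangeFunction V hf] with ω h2 h3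
    exact ((isFrameWithBounds_iff_of_fintype hA hB).1 h2).2 _ h3
  have hi := integrableOn_norm_sq_fiber f
  -- The upper bound is what makes each bracket square integrable, as Parseval requires.
  have h2 : ∀ i, MemLp (fun ω => inner ℂ (fiber (φ i) ω) (fiber f ω)) 2
      (volume.restrict (unitCube d)) := fun i => by
    have hm := (integrableOn_inner_fiber (φ i) f).aestronglyMeasurable
    refine (memLp_two_iff_integrable_sq_norm hm).2
      ((hi.const_mul B).mono' (hm.norm.pow 2) ?_)
    filter_upwards [h1] with ω hω
    rw [Real.norm_of_nonneg (by positivity)]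
    exact (Finset.single_le_sum (f := fun i => ‖inner ℂ (fiber (φ i) ω) (fiber f ω)‖ ^ 2)
      (fun _ _ => by positivity) (Finset.mem_univ i)).trans hω.2
  have h3 := hasSum_sq_inner_intShift h2
  have h4 : IntegrableOn (fun ω => ∑ i, ‖inner ℂ (fiber (φ i) ω) (fiber f ω)‖ ^ 2)
      (unitCube d) :=
    integrable_finsetSum _ fun i _ => (h2 i).integrable_norm_pow two_ne_zero
  refine ⟨h3.summable, ?_, ?_⟩
  · rw [h3.tsum_eq, ← integral_norm_sq_fiber, ← integral_const_mul]
    exact integral_mono_ae (hi.const_mul A) h4 (h1.mono fun _ h => h.1)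
  · rw [h3.tsum_eq, ← integral_norm_sq_fiber, ← integral_const_mul]
    exact integral_mono_ae h4 (hi.const_mul B) (h1.mono fun _ h => h.2)

/-! ### Riesz sequences of translates -/

theorem isFiniteMeasure_restrict_unitCube (d : ℕ) :
    IsFiniteMeasure ((volume : Measure (RSpace d)).restrict (unitCube d)) := by
  rw [← (measurePreserving_torusSection d).map_eq]
  infer_instance

theorem character_add {d : ℕ} (k l : Fin d → ℤ) (ω : RSpace d) :
    character (k + l) ω = character k ω * character l ω := UnitAddTorus.mFourier_add

theorem integral_character {d : ℕ} (k : Fin d → ℤ) :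
    ∫ ω in unitCube d, character k ω = if k = 0 then 1 else 0 := by
  have h1 := orthonormal_iff_ite.1 (UnitAddTorus.orthonormal_mFourier (d := Fin d)) 0 k
  have h2 := integral_mFourier_mul_comp_torusSection (d := d) (h := fun _ => 1)
    aestronglyMeasurable_const k
  simp only [mul_one] at h2
  rw [← h2]
  simp only [ContinuousMap.inner_toLp, UnitAddTorus.mFourier_zero, ContinuousMap.one_apply,
    map_one, mul_one, eq_comm (a := (0 : Fin d → ℤ))] at h1
  exact h1

theorem memLp_trigPolynomial {d : ℕ} (t : Finset (Fin d → ℤ)) (a : (Fin d → ℤ) → ℂ) :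
    MemLp (fun ω => ∑ k ∈ t, a k * character (-k) ω) 2 (volume.restrict (unitCube d)) := by
  have := isFiniteMeasure_restrict_unitCube d
  refine MemLp.of_bound (Continuous.aestronglyMeasurable (continuous_finsetSum _ fun k _ =>
    continuous_const.mul (continuous_character (-k)))) (∑ k ∈ t, ‖a k‖)
    (Eventually.of_forall fun ω => (norm_sum_le _ _).trans_eq ?_)
  simp [norm_character]

theorem integral_norm_sq_trigPolynomial {d : ℕ} (t : Finset (Fin d → ℤ)) (a : (Fin d → ℤ) → ℂ) :
    ∫ ω in unitCube d, ‖∑ k ∈ t, a k * character (-k) ω‖ ^ 2 = ∑ k ∈ t, ‖a k‖ ^ 2 := by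
  classical
  have := isFiniteMeasure_restrict_unitCube d
  have h1 := hasSum_sq_fourierCoeff_unitCube (memLp_trigPolynomial t a)
  have h2 : ∀ m, ∫ ω in unitCube d, character m ω * ∑ k ∈ t, a k * character (-k) ω
      = if m ∈ t then a m else 0 := fun m => by
    have h3 : ∀ ω : RSpace d, character m ω * ∑ k ∈ t, a k * character (-k) ω
        = ∑ k ∈ t, a k * character (m - k) ω := fun ω => by
      rw [Finset.mul_sum]
      refine Finset.sum_congr rfl fun k _ => ?_
      rw [sub_eq_add_neg, character_add]
      ring
    simp_rw [h3]
    rw [integral_finsetSum]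
    · simp_rw [integral_const_mul, integral_character, sub_eq_zero]
      simp
    · intro k _
      refine Integrable.const_mul (Integrable.of_bound
        (continuous_character (m - k)).aestronglyMeasurable 1
        (Eventually.of_forall fun ω => (norm_character _ ω).le)) _
  simp_rw [h2] at h1
  refine h1.unique ?_
  have h4 : ∑ k ∈ t, ‖a k‖ ^ 2 = ∑ k ∈ t, ‖if k ∈ t then a k else 0‖ ^ 2 :=
    Finset.sum_congr rfl fun k hk => by simp [hk]
  rw [h4]
  exact hasSum_sum_of_ne_finset_zero fun k hk => by simp [hk]

/-- The fibers of a Riesz sequence of translates are almost everywhere linearly independent. -/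
theorem ae_linearIndependent_fiber {d n : ℕ} {φ : Fin n → L2Space d}
    (h : IsRieszSequence fun p : Fin n × (Fin d → ℤ) => intShift p.2 (φ p.1)) :
    ∀ᵐ ω ∂volume.restrict (unitCube d), LinearIndependent ℂ fun i => fiber (φ i) ω := by
  have hfin := isFiniteMeasure_restrict_unitCube d
  -- `f j` is orthogonal to every translate except `φ j` itself. Its bracket with `φ i`, `i ≠ j`,
  -- therefore vanishes, and its bracket with `φ j` has only the zeroth Fourier coefficient, so it
  -- is a nonzero constant.
  choose f hf0 hf1 using fun j : Fin n => h.exists_inner_eq_zero (j, 0)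
  have h0 : ∀ᵐ ω ∂volume.restrict (unitCube d), ∀ i j, i ≠ j →
      inner ℂ (fiber (φ i) ω) (fiber (f j) ω) = 0 := by
    refine ae_all_iff.2 fun i => ae_all_iff.2 fun j => ?_
    by_cases hij : i = j
    · simp [hij]
    · filter_upwards [ae_inner_fiber_eq_zero (g := φ i) (f := f j)
        fun k => hf0 j (i, k) (by simp [hij])] with ω hω _
      exact hω
  have h1 : ∀ᵐ ω ∂volume.restrict (unitCube d), ∀ j,
      inner ℂ (fiber (φ j) ω) (fiber (f j) ω) ≠ 0 := by
    refine ae_all_iff.2 fun j => ?_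
    have hi := integrableOn_inner_fiber (φ j) (f j)
    have hsub : ∀ᵐ ω ∂volume.restrict (unitCube d), inner ℂ (fiber (φ j) ω) (fiber (f j) ω)
        - inner ℂ (intShift 0 (φ j)) (f j) = 0 := by
      refine ae_eq_zero_of_fourierCoeff_unitCube (hi.sub (integrable_const _)) fun k => ?_
      simp_rw [mul_sub]
      rw [integral_sub, ← inner_intShift, integral_mul_const, integral_character]
      · by_cases hk : k = 0
        · simp [hk]
        · simp [hk, hf0 j (j, k) (by simp [hk])]
      · exact hi.bdd_mul (continuous_character k).aestronglyMeasurable (c := 1)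
          (Eventually.of_forall fun ω => (norm_character k ω).le)
      · exact (integrable_const _).bdd_mul (continuous_character k).aestronglyMeasurable (c := 1)
          (Eventually.of_forall fun ω => (norm_character k ω).le)
    filter_upwards [hsub] with ω hω
    rw [sub_eq_zero.1 hω]
    exact hf1 j
  filter_upwards [h0, h1] with ω h0 h1
  rw [Fintype.linearIndependent_iff]
  intro c hc j
  have h2 : inner ℂ (fiber (f j) ω) (∑ i, c i • fiber (φ i) ω) = 0 := by rw [hc, inner_zero_right]
  rw [inner_sum, Finset.sum_eq_single j] at h2
  · rw [inner_smul_right, mul_eq_zero] at h2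
    exact h2.resolve_right fun h3 => h1 j (by rw [← inner_conj_symm, h3, map_zero])
  · intro i _ hij
    rw [inner_smul_right, ← inner_conj_symm, h0 i j hij]
    simp
  · simp

/-- The fiber of a finite combination of translates is `∑ P i ω • τφ_i(ω)` with trigonometric
polynomials `P i`. The pointwise bound is used with coefficients `P i ω`, so its null set must not
depend on `c`; integrating and applying Parseval to each `P i` finishes. -/
theorem le_norm_sq_sum_intShift {d n : ℕ} {φ : Fin n → L2Space d} {A : ℝ}
    (h : ∀ᵐ ω ∂volume.restrict (unitCube d), ∀ c : Fin n → ℂ,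
      A * ∑ i, ‖c i‖ ^ 2 ≤ ‖∑ i, c i • fiber (φ i) ω‖ ^ 2) (c : Fin n × (Fin d → ℤ) →₀ ℂ) :
    A * ∑ p ∈ c.support, ‖c p‖ ^ 2 ≤ ‖∑ p ∈ c.support, c p • intShift p.2 (φ p.1)‖ ^ 2 := by
  classical
  set t := c.support.image Prod.snd with ht
  have hsub : c.support ⊆ Finset.univ ×ˢ t := fun p hp => by
    simpa [ht] using ⟨p.1, Finsupp.mem_support_iff.1 hp⟩
  have e1 : ∑ p ∈ c.support, ‖c p‖ ^ 2 = ∑ i, ∑ k ∈ t, ‖c (i, k)‖ ^ 2 := by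
    rw [← Finset.sum_product' (f := fun i k => ‖c (i, k)‖ ^ 2)]
    exact Finset.sum_subset hsub fun p _ hp => by simp [Finsupp.notMem_support_iff.1 hp]
  have e2 : ∑ p ∈ c.support, c p • intShift p.2 (φ p.1)
      = ∑ p ∈ Finset.univ ×ˢ t, c p • intShift p.2 (φ p.1) :=
    Finset.sum_subset hsub fun p _ hp => by simp [Finsupp.notMem_support_iff.1 hp]
  let P : Fin n → RSpace d → ℂ := fun i ω => ∑ k ∈ t, c (i, k) * character (-k) ω
  have hP : ∀ i, IntegrableOn (fun ω => ‖P i ω‖ ^ 2) (unitCube d) := fun i =>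
    (memLp_trigPolynomial t fun k => c (i, k)).integrable_norm_pow two_ne_zero
  rw [e1, e2, ← integral_norm_sq_fiber]
  have e3 : A * ∑ i, ∑ k ∈ t, ‖c (i, k)‖ ^ 2 = ∫ ω in unitCube d, A * ∑ i, ‖P i ω‖ ^ 2 := by
    rw [integral_const_mul, integral_finsetSum _ fun i _ => hP i]
    congr 1
    exact Finset.sum_congr rfl fun i _ =>
      (integral_norm_sq_trigPolynomial t fun k => c (i, k)).symm
  rw [e3]
  refine integral_mono_ae ((integrable_finsetSum _ fun i _ => hP i).const_mul A)
    (integrableOn_norm_sq_fiber _) ?_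
  filter_upwards [h, ae_fiber_sum_smul (Finset.univ ×ˢ t) c fun p => intShift p.2 (φ p.1),
    (Finset.eventually_all (Finset.univ ×ˢ t)).2 fun p _ => ae_fiber_intShift p.2 (φ p.1)]
    with ω h1 h2 h3
  have h4 : fiber (∑ p ∈ Finset.univ ×ˢ t, c p • intShift p.2 (φ p.1)) ω
      = ∑ i, P i ω • fiber (φ i) ω := by
    rw [h2, Finset.sum_congr rfl fun p hp => by rw [h3 p hp], Finset.sum_product]
    simp only [P, Finset.sum_smul, mul_smul]
  rw [h4]
  exact h1 fun i => P i ω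

theorem isRieszBasis_of_isFrameWithBounds {H ι : Type*} [NormedAddCommGroup H]
    [InnerProductSpace ℂ H] {K : Submodule ℂ H} {v : ι → H} {A B : ℝ}
    (h : IsFrameWithBounds K v A B)
    (hl : ∀ c : ι →₀ ℂ, A * ∑ i ∈ c.support, ‖c i‖ ^ 2 ≤ ‖∑ i ∈ c.support, c i • v i‖ ^ 2) :
    IsRieszBasis K v := by
  -- Frame bounds are quadratic and Riesz bounds are not, hence the square roots.
  refine ⟨⟨√A, √B, Real.sqrt_pos.2 h.1, Real.sqrt_pos.2 h.2.1, fun c => ⟨?_, ?_⟩⟩, A, B, h⟩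
  · rw [← Real.sqrt_mul h.1.le]
    exact Real.sqrt_le_iff.2 ⟨norm_nonneg _, hl c⟩
  · rw [← Real.sqrt_mul h.2.1.le]
    exact Real.le_sqrt_of_sq_le (h.norm_sq_sum_le _ _)

theorem weaving_apply {ι X Y : Type*} (I : Set ι) (v w : ι → X) (F : X → Y) :
    (fun i => F (weaving I v w i)) = weaving I (fun i => F (v i)) fun i => F (w i) := by
  funext i
  simp only [weaving]
  split_ifs <;> rfl

theorem IsRieszGeneratorSet.mem {d n : ℕ} {V : Submodule ℂ (L2Space d)} {φ : Fin n → L2Space d}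
    (h : IsRieszGeneratorSet V φ) (i : Fin n) : φ i ∈ V := by
  obtain ⟨-, A, B, -, -, h, -⟩ := h
  simpa [intShift_zero] using h (i, 0)

theorem mainTheorem4 (d n : ℕ) (V : Submodule ℂ (L2Space d)) (hV : IsShiftInvariantSpace V)
    (φ ψ : Fin n → L2Space d) (hφ : IsRieszGeneratorSet V φ) (hψ : IsRieszGeneratorSet V ψ) :
    AreWovenGeneratorSets V φ ψ ↔
      ∃ A B : ℝ, 0 < A ∧ 0 < B ∧ ∀ᵐ ω ∂volume.restrict (unitCube d),
        AreWovenWithBounds (rangeFunction V ω)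
          (fun i => fiber (φ i) ω) (fun i => fiber (ψ i) ω) A B := by
  constructor
  · intro h
    choose A B hAB using fun I => (h I).2
    -- There are finitely many subsets `I`, so the extreme bounds serve all weavings.
    obtain ⟨I₀, hI₀⟩ := Finite.exists_min A
    obtain ⟨I₁, hI₁⟩ := Finite.exists_max B
    refine ⟨A I₀, B I₁, (hAB I₀).1, (hAB I₁).2.1, ?_⟩
    refine ae_all_iff.2 fun I => ?_
    filter_upwards [ae_isFrameWithBounds_fiber hV (hAB I)] with ω hω
    rw [weaving_apply I φ ψ fun f => fiber f ω] at hω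
    exact hω.mono (hAB I₀).1 (hI₀ I) (hI₁ I)
  · rintro ⟨A, B, hA, hB, h⟩ I
    have hI : ∀ᵐ ω ∂volume.restrict (unitCube d), IsFrameWithBounds (rangeFunction V ω)
        (fun i => fiber (weaving I φ ψ i) ω) A B := by
      filter_upwards [h] with ω hω
      rw [weaving_apply I φ ψ fun f => fiber f ω]
      exact hω I
    have hmem : ∀ i, weaving I φ ψ i ∈ V := fun i => by
      simp only [weaving]
      split_ifs
      exacts [hφ.mem i, hψ.mem i]
    refine isRieszBasis_of_isFrameWithBounds (isFrameWithBounds_of_ae_fiber hV hmem hA hB hI)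
      (le_norm_sq_sum_intShift ?_)
    -- The independent fibers of `φ` bound the dimension of `J(ω)` from below, whichever weaving `I`
    -- is considered.
    filter_upwards [hI, ae_linearIndependent_fiber hφ.1,
      ae_all_iff.2 fun i => fiber_mem_rangeFunction V (hφ.mem i)] with ω h1 h2 h3
    exact h1.le_norm_sq_sum h2 h3
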